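/- Let $K$ be a field that is complete for a discrete valuation $\mathrm{val}$, let $K^\circ$ be its ring of integers and $\pi$ a uniformizer, with $\mathrm{val}(\pi)=1$. For $\mathbf r\in\mathbb Q^n$ let $$K\{\mathbf X;\mathbf r\}=\Big\{\sum_{\mathbf i\in\mathbb N^n}a_{\mathbf i}\mathbf X^{\mathbf i}\ :\ a_{\mathbf i}\in K,\ \mathrm{val}(a_{\mathbf i})-\mathbf r\cdot\mathbf i\to+\infty\text{ as }|\mathbf i|\to\infty\Big\}$$ be the Tate algebra with log-radii $\mathbf r$. Its Gauss norm is $\|f\|_{\mathbf r}=\sup_{\mathbf i}|\pi|^{\mathrm{val}(a_{\mathbf i})-\mathbf r\cdot\mathbf i}$ (with $|\pi|\in(0,1)$ fixed). For an endomorphism $f$ of a finite-dimensional $K$-vector space with characteristic polynomial $\chi_f$, and $s\in\mathbb R$, let $\chi_{\mathrm{Big},s,f}\in K[T]$ be the monic factor of $\chi_f$ whose roots are, with multiplicity, the roots of $\chi_f$ in an algebraic closure of $K$ that have valuation $<s$. Let $\mathrm{Big}_s(f)=\ker\chi_{\mathrm{Big},s,f}(f)$. Let $\mathbf r,\mathbf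 u\in\mathbb Q^n$ with $r_i\ge u_i$ for all $i$, so that $K\{\mathbf X;\mathbf r\}\subset K\{\mathbf X;\mathbf u\}$. Let $I$ be an ideal of $K\{\mathbf X;\mathbf r\}$ such that $V=K\{\mathbf X;\mathbf r\}/I$ has finite dimension over $K$. Put $J=I\cdot K\{\mathbf X;\mathbf u\}$ and $W=K\{\mathbf X;\mathbf u\}/J$, let $\Phi:V\to W$ be the map induced by the inclusion, and let $T_i:V\to V$ be the multiplication by $X_i$. For $x\in V$ let $\|x\|_V=\inf\|\hat x\|_{\mathbf u}$ over all lifts $\hat x\in K\{\mathbf X;\mathbf r\}$ of $x$, and let $N=\{x\in V:\|x\|_V=0\}$. **Proposition.** We have $$\ker\Phi=N=\sum_{i=1}^n\mathrm{Big}_{-u_i}(T_i).$$ Moreover, let $W'=V/\sum_i\mathrm{Big}_{-u_i}(T_i)$ with the seminorm induced by $\|\cdot\|_V$ (the infimum of $\|\cdot\|_V$ over representatives) and the operators $T_i$ induced on it. Then the unit ball $D'=\{x\in W':\|x\|\le1\}$ is a finitely generated $K^\circ$-submodule of $W'$ that spans $W'$ over $K$. It is the smallest $K^\circ$-submodule of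 $W'$ that contains the image of $1$ and is saturated, i.e. stable under $aT_1^{k_1}\cdots T_n^{k_n}$ for all $a\in K$ and $\mathbf k\in\mathbb N^n$ with $\mathrm{val}(a)-\mathbf u\cdot\mathbf k\ge0$. If $\mathbf u\in\mathbb Z^n$, then $$D'=\mathrm{Sat}_{\pi^{u_1}T_1}\cdots\mathrm{Sat}_{\pi^{u_n}T_n}(L_0),$$ where $L_0$ is the $K^\circ$-submodule of $W'$ generated by the image of $1$ and $\mathrm{Sat}_f(L)=\sum_{k\ge0}f^k(L)$. -/

import Mathlib

open Polynomial

namespace TateFGLM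

noncomputable section

/-- `π` is a uniformizer of the discretely valued field `K`.  The valuation `val` of `K`, normalized
by `val π = 1`, and the norm are related by `‖x‖ = ‖π‖ ^ (val x)`; the last field says that `val`
takes integral values on nonzero elements. -/
structure IsUniformizer {K : Type*} [NormedField K] (π : K) : Prop where
  ne_zero : π ≠ 0
  norm_lt_one : ‖π‖ < 1
  discrete : ∀ x : K, x ≠ 0 → ∃ k : ℤ, ‖x‖ = ‖π‖ ^ k

/-- The ring of integers `K° = {x | ‖x‖ ≤ 1} = {x | 0 ≤ val x}`. -/
abbrev integers (K : Type*) [NormedField K] [IsUltrametricDist K] : Subring K :=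
  (NormedField.valuation (K := K)).integer

/-! ### Slope decomposition -/

section Slopes

variable {K : Type*} [NormedField K] (π : K) (s : ℝ)

/-- `IsBigRoot π s x` means `val x < s` for `x` algebraic over `K`, where `val` is the extension of
the valuation of `K`, so that `spectralNorm K _ x = ‖π‖ ^ (val x)` and `val 0 = ∞`. -/
def IsBigRoot (x : AlgebraicClosure K) : Prop :=
  ‖π‖ ^ s < spectralNorm K (AlgebraicClosure K) x

open Classical in
/-- The factor of a monic polynomial `χ` over `K` that corresponds to the roots of valuation `< s`
in an algebraic closure, counted with multiplicity: the product of the monic irreducible factors of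
`χ` over `K` that have such a root.  See `map_bigFactor`. -/
def bigFactor (χ : K[X]) : K[X] :=
  ((UniqueFactorizationMonoid.normalizedFactors χ).filter fun P =>
    ∃ x ∈ P.aroots (AlgebraicClosure K), IsBigRoot π s x).prod

open Classical in
lemma filter_aroots_of_irreducible {P : K[X]} (hP : Irreducible P) (hm : P.Monic) :
    ((P.aroots (AlgebraicClosure K)).filter (IsBigRoot π s)) =
      if ∃ x ∈ P.aroots (AlgebraicClosure K), IsBigRoot π s x then
        P.aroots (AlgebraicClosure K) else 0 := by
  have key : ∀ x ∈ P.aroots (AlgebraicClosure K), minpoly K x = P := by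
    intro x hx
    rw [mem_aroots] at hx
    exact (minpoly.eq_of_irreducible_of_monic hP hx.2 hm).symm
  split_ifs with h
  · obtain ⟨x, hx, hbx⟩ := h
    rw [Multiset.filter_eq_self]
    intro y hy
    unfold IsBigRoot spectralNorm at *
    rw [key y hy]
    rwa [key x hx] at hbx
  · rw [Multiset.filter_eq_nil]
    intro y hy hby
    exact h ⟨y, hy, hby⟩

open Classical in
/-- Over an algebraic closure, `bigFactor π s χ` is the product of the linear factors of `χ` at the
roots of valuation `< s`. -/
theorem map_bigFactor {χ : K[X]} (hχ : χ.Monic) :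
    (bigFactor π s χ).map (algebraMap K (AlgebraicClosure K)) =
      (((χ.aroots (AlgebraicClosure K)).filter (IsBigRoot π s)).map fun x => X - C x).prod := by
  have aux : ∀ S : Multiset K[X], (∀ P ∈ S, Irreducible P ∧ P.Monic) →
      ((S.filter fun P => ∃ x ∈ P.aroots (AlgebraicClosure K), IsBigRoot π s x).prod).map
        (algebraMap K (AlgebraicClosure K)) =
      (((S.prod.aroots (AlgebraicClosure K)).filter (IsBigRoot π s)).map
        fun x => X - C x).prod := by
    intro S
    induction S using Multiset.induction_on with
    | empty => intro _; simp
    | cons P S ih =>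
      intro h
      have hP := h P (Multiset.mem_cons_self P S)
      have hS : ∀ Q ∈ S, Irreducible Q ∧ Q.Monic := fun Q hQ => h Q (Multiset.mem_cons_of_mem hQ)
      have hS0 : S.prod ≠ 0 := by
        refine Multiset.prod_ne_zero fun h0 => (hS 0 h0).1.ne_zero rfl
      have hmul : P * S.prod ≠ 0 := mul_ne_zero hP.1.ne_zero hS0
      rw [Multiset.prod_cons, aroots_mul hmul, Multiset.filter_add, Multiset.map_add,
        Multiset.prod_add, ← ih hS, filter_aroots_of_irreducible π s hP.1 hP.2]
      split_ifs with hb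
      · rw [Multiset.filter_cons_of_pos (p := fun P : K[X] =>
          ∃ x ∈ P.aroots (AlgebraicClosure K), IsBigRoot π s x) S hb, Multiset.prod_cons,
          Polynomial.map_mul]
        congr 1
        exact (IsAlgClosed.splits _).eq_prod_roots_of_monic (hP.2.map _)
      · rw [Multiset.filter_cons_of_neg (p := fun P : K[X] =>
          ∃ x ∈ P.aroots (AlgebraicClosure K), IsBigRoot π s x) S hb]
        simp
  have hprod : (UniqueFactorizationMonoid.normalizedFactors χ).prod = χ := by
    rw [UniqueFactorizationMonoid.prod_normalizedFactors_eq hχ.ne_zero]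
    exact hχ.normalize_eq_self
  have := aux (UniqueFactorizationMonoid.normalizedFactors χ) fun P hP =>
    have hirr := UniqueFactorizationMonoid.irreducible_of_normalized_factor P hP
    ⟨hirr, by
      rw [← UniqueFactorizationMonoid.normalize_normalized_factor P hP]
      exact monic_normalize hirr.ne_zero⟩
  rw [hprod] at this
  exact this

variable {V : Type*} [AddCommGroup V] [Module K V] [Module.Finite K V]

/-- `Big_s(f)`: the kernel of `χ_{Big,s,f}(f)`, i.e. the sum of the generalized eigenspaces of `f`
whose eigenvalues have valuation `< s`. -/
def Big (f : Module.End K V) : Submodule K V :=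
  LinearMap.ker (aeval f (bigFactor π s f.charpoly))

lemma Big_le_comap {f g : Module.End K V} (h : Commute f g) :
    Big π s f ≤ (Big π s f).comap g := by
  intro x hx
  have hx' : aeval f (bigFactor π s f.charpoly) x = 0 := hx
  have hc : Commute (aeval f (bigFactor π s f.charpoly)) g := by
    rw [Polynomial.aeval_eq_sum_range]
    exact Commute.sum_left _ _ _ fun i _ => (h.pow_left i).smul_left _
  change aeval f (bigFactor π s f.charpoly) (g x) = 0
  rw [← Module.End.mul_apply, hc.eq, Module.End.mul_apply, hx', map_zero]

end Slopes

/-! ### Saturation -/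

section Saturation

variable {K : Type*} [NormedField K] [IsUltrametricDist K]
  {V : Type*} [AddCommGroup V] [Module K V]

/-- `Sat_f(L) = L + f(L) + f²(L) + ⋯`. -/
def Sat (f : Module.End K V) (L : Submodule (integers K) V) : Submodule (integers K) V :=
  ⨆ k : ℕ, L.map ((f ^ k).restrictScalars (integers K))

end Saturation

/-! ### Tate algebras -/

section Tate

variable {K : Type*} [NormedField K] [IsUltrametricDist K] {n : ℕ}

/-- The norms `‖π‖ ^ (-r i)` of the variables for the log-radii `r`. -/
def radii (π : K) (r : Fin n → ℚ) : Fin n → ℝ := fun i => ‖π‖ ^ (-(r i : ℝ))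

/-- The Tate algebra `K{X; r}`: the power series `∑ a_i X^i` such that
`‖a_i‖ * ‖π‖ ^ (-(r · i)) = ‖π‖ ^ (val a_i - r · i)` tends to `0` as `|i| → ∞`. -/
def Tate (π : K) (r : Fin n → ℚ) : Subalgebra K (MvPowerSeries (Fin n) K) where
  __ := MvPowerSeries.IsRestricted.subring (radii π r)
  algebraMap_mem' a := MvPowerSeries.isRestricted_C (radii π r) a

/-- The variable `X_i` of the Tate algebra. -/
def Tate.X (π : K) (r : Fin n → ℚ) (i : Fin n) : Tate π r :=
  ⟨MvPowerSeries.X i, MvPowerSeries.isRestricted_monomial (radii π r) _ _⟩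

lemma Tate.mono {π : K} (hπ : IsUniformizer π) {r u : Fin n → ℚ} (hur : u ≤ r) :
    Tate π r ≤ Tate π u := by
  have hpos : 0 < ‖π‖ := norm_pos_iff.mpr hπ.ne_zero
  intro f hf
  have hf' : Filter.Tendsto (fun t : Fin n →₀ ℕ =>
    ‖MvPowerSeries.coeff t f‖ * t.prod (radii π r · ^ ·)) Filter.cofinite (nhds 0) := hf
  change Filter.Tendsto (fun t : Fin n →₀ ℕ =>
    ‖MvPowerSeries.coeff t f‖ * t.prod (radii π u · ^ ·)) Filter.cofinite (nhds 0)
  have hle : ∀ i, radii π u i ≤ radii π r i := fun i =>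
    Real.rpow_le_rpow_of_exponent_ge hpos hπ.norm_lt_one.le
      (neg_le_neg (by exact_mod_cast hur i))
  have h0 : ∀ i, 0 ≤ radii π u i := fun i => Real.rpow_nonneg hpos.le _
  refine squeeze_zero (fun t => mul_nonneg (norm_nonneg _)
    (Finset.prod_nonneg fun i _ => pow_nonneg (h0 i) _)) (fun t => ?_) hf'
  exact mul_le_mul_of_nonneg_left (Finset.prod_le_prod (fun i _ => pow_nonneg (h0 i) _)
    fun i _ => pow_le_pow_left₀ (h0 i) (hle i) _) (norm_nonneg _)

/-- The inclusion `K{X; r} → K{X; u}` for `u ≤ r`. -/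
def Tate.incl {π : K} (hπ : IsUniformizer π) {r u : Fin n → ℚ} (hur : u ≤ r) :
    Tate π r →ₐ[K] Tate π u :=
  Subalgebra.inclusion (Tate.mono hπ hur)

/-- The Gauss norm `‖f‖_u = ⨆ ‖a_i‖ * ‖π‖ ^ (-(u · i)) = ‖π‖ ^ (val_u f)`. -/
def gaussNorm (π : K) (u : Fin n → ℚ) (f : MvPowerSeries (Fin n) K) : ℝ :=
  MvPowerSeries.gaussNorm (fun a : K => ‖a‖) (radii π u) f

/-! ### The quotients `V = K{X; r} / I` and `W = K{X; u} / J` -/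

variable {π : K} {r : Fin n → ℚ} (u : Fin n → ℚ) (I : Ideal (Tate π r))

/-- The map `Φ : V → W = K{X; u} / J`, `J = I · K{X; u}`, induced by the inclusion. -/
def Phi (hπ : IsUniformizer π) {u : Fin n → ℚ} (hur : u ≤ r) :
    (Tate π r ⧸ I) →ₐ[K] (Tate π u ⧸ I.map (Tate.incl hπ hur)) :=
  Ideal.quotientMapₐ (I.map (Tate.incl hπ hur)) (Tate.incl hπ hur) Ideal.le_comap_map

/-- The seminorm `‖x‖_V = inf ‖f‖_u` over the lifts `f ∈ K{X; r}` of `x ∈ V`. -/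
def seminormV (x : Tate π r ⧸ I) : ℝ :=
  ⨅ f : {f : Tate π r // Ideal.Quotient.mk I f = x},
    gaussNorm π u (f.1 : MvPowerSeries (Fin n) K)

/-- The multiplication operator `T_i` by `X_i` on `V`. -/
def mulX (i : Fin n) : Module.End K (Tate π r ⧸ I) :=
  LinearMap.mulLeft K (Ideal.Quotient.mk I (Tate.X π r i))

lemma mulX_apply (i : Fin n) (x : Tate π r ⧸ I) :
    mulX I i x = Ideal.Quotient.mk I (Tate.X π r i) * x := rfl

lemma commute_mulX (i j : Fin n) : Commute (mulX I i) (mulX I j) := by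
  have key : ∀ a b c : Tate π r ⧸ I, a * (b * c) = b * (a * c) := fun a b c =>
    mul_left_comm a b c
  refine LinearMap.ext fun x => ?_
  rw [Module.End.mul_apply, Module.End.mul_apply, mulX_apply, mulX_apply, mulX_apply, mulX_apply]
  exact key _ _ _

variable [Module.Finite K (Tate π r ⧸ I)]

/-- `N' = ∑ i, Big_{-u_i}(T_i)`. -/
def sumBig : Submodule K (Tate π r ⧸ I) :=
  ⨆ i, Big π (-(u i : ℝ)) (mulX I i)

lemma sumBig_le_comap (j : Fin n) : sumBig u I ≤ (sumBig u I).comap (mulX I j) := by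
  refine iSup_le fun i => ?_
  exact (Big_le_comap π _ (commute_mulX I i j)).trans
    (Submodule.comap_mono (le_iSup (fun i => Big π (-(u i : ℝ)) (mulX I i)) i))

/-- The quotient `W' = V / N'`. -/
abbrev QuotBig : Type _ := (Tate π r ⧸ I) ⧸ sumBig u I

/-- The operator induced by `T_i` on `W'`. -/
def mulXQuot (i : Fin n) : Module.End K (QuotBig u I) :=
  (sumBig u I).mapQ (sumBig u I) (mulX I i) (sumBig_le_comap u I i)

/-- The image of `1` in `W'`. -/
def oneQuot : QuotBig u I := (sumBig u I).mkQ 1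

/-- The seminorm on `W'` induced by `‖·‖_V`. -/
def seminormQuot (w : QuotBig u I) : ℝ :=
  ⨅ x : {x : Tate π r ⧸ I // (sumBig u I).mkQ x = w}, seminormV u I x.1

/-- `L` is saturated: it is stable under all operators `a T_1 ^ k_1 ⋯ T_n ^ k_n` attached to the
terms `a X ^ k` of Gauss norm `‖a X ^ k‖_u ≤ 1`. -/
def IsSaturated (L : Submodule (integers K) (QuotBig u I)) : Prop :=
  ∀ (a : K) (k : Fin n → ℕ), ‖a‖ * ∏ i, radii π u i ^ k i ≤ 1 →
    ∀ x ∈ L, a • ((List.ofFn fun i => mulXQuot u I i ^ k i).prod x) ∈ L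

/-- The iterated saturation `Sat_{π^{w_1} T_1} (⋯ (Sat_{π^{w_n} T_n} (L)))` on `W'`. -/
def iterSat (w : Fin n → ℤ) (L : Submodule (integers K) (QuotBig u I)) :
    Submodule (integers K) (QuotBig u I) :=
  (List.finRange n).foldr (fun i M => Sat (π ^ w i • mulXQuot u I i) M) L

end Tate

end

end TateFGLM

/-! Factor the characteristic polynomial of each T_i as Q_i g_i, where Q_i carries the roots of
valuation < -u_i. At the radius of X_i for log-radii u, the constant coefficient of Q_i strictly
dominates, so Q_i(X_i) is a unit of K{X; u}; the leading coefficient of g_i dominates, so rewriting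
by g_i lowers exponents without increasing norms.

The kernels agree by the cycle ∑ Big ⊆ ker Φ ⊆ N ⊆ ∑ Big. The first inclusion is the unit property
(`Tate.isUnit_aeval_X`). The second holds because J lies in the closure of I for the Gauss norm at u
(`mem_closure_of_mem_map`), polynomials being dense.

The third, like the claims on the unit ball, rests on the lattice `termSpan` of W' spanned by the
terms a X^k of Gauss norm at most 1. It is finitely generated, because g_i(T_i) = 0 on W'
(`termSpan_fg`), and contains the image of every f with ‖f‖_u ≤ 1 (`toQuotBig_mem_termSpan`). All
K-multiples of an element of N therefore land in a finitely generated lattice, which contains no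
line. The delicate point is that f is an infinite series: its tail is small for the norm at r, and
is handled by division, with bounded remainder, by polynomials lying in I (`Tate.exists_remainder`).

Finally, the Gauss norms of terms leave a gap above 1, so the unit ball is exactly `termSpan`;
minimality and iterated saturation become statements about monomials. -/

namespace TateFGLM

noncomputable section

/-! ### The Gauss norm and completeness of Tate algebras -/

section NormedTate

variable {K : Type*} [NormedField K] [IsUltrametricDist K] {n : ℕ}

/-- The weight `∏ i, ρ i ^ k i` of an exponent. -/
def weight (ρ : Fin n → ℝ) (k : Fin n →₀ ℕ) : ℝ := k.prod (ρ · ^ ·)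

lemma weight_eq (ρ : Fin n → ℝ) (k : Fin n →₀ ℕ) : weight ρ k = ∏ i, ρ i ^ k i :=
  Finsupp.prod_fintype _ _ fun _ => pow_zero _

lemma weight_add (ρ : Fin n → ℝ) (k l : Fin n →₀ ℕ) :
    weight ρ (k + l) = weight ρ k * weight ρ l := by
  simp [weight_eq, pow_add, Finset.prod_mul_distrib]

lemma weight_zero (ρ : Fin n → ℝ) : weight ρ 0 = 1 := by simp [weight_eq]

lemma weight_single (ρ : Fin n → ℝ) (i : Fin n) (j : ℕ) :
    weight ρ (Finsupp.single i j) = ρ i ^ j := by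
  simp [weight, Finsupp.prod_single_index]

lemma weight_pos {ρ : Fin n → ℝ} (hρ : ∀ i, 0 < ρ i) (k : Fin n →₀ ℕ) : 0 < weight ρ k := by
  rw [weight_eq]
  exact Finset.prod_pos fun i _ => pow_pos (hρ i) _

omit [IsUltrametricDist K] in
lemma radii_pos {π : K} (hπ : π ≠ 0) (r : Fin n → ℚ) (i : Fin n) : 0 < radii π r i :=
  Real.rpow_pos_of_pos (norm_pos_iff.mpr hπ) _

variable {π : K} {r : Fin n → ℚ}

/-- The coefficients of an element of the Tate algebra. -/
def Tate.coeff (k : Fin n →₀ ℕ) : Tate π r →ₗ[K] K :=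
  (MvPowerSeries.coeff k).comp (Tate π r).val.toLinearMap

lemma Tate.coeff_apply (k : Fin n →₀ ℕ) (f : Tate π r) :
    Tate.coeff k f = MvPowerSeries.coeff k (f : MvPowerSeries (Fin n) K) := rfl

lemma Tate.ext {f g : Tate π r} (h : ∀ k, Tate.coeff k f = Tate.coeff k g) : f = g :=
  Subtype.ext (MvPowerSeries.ext h)

lemma Tate.tendsto_coeff (f : Tate π r) :
    Filter.Tendsto (fun k => ‖Tate.coeff k f‖ * weight (radii π r) k) Filter.cofinite (nhds 0) :=
  f.2

lemma Tate.hasGaussNorm (f : Tate π r) :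
    MvPowerSeries.HasGaussNorm (fun a : K => ‖a‖) (radii π r) (f : MvPowerSeries (Fin n) K) :=
  (Tate.tendsto_coeff f).bddAbove_range_of_cofinite

lemma isNonarchimedean_norm : IsNonarchimedean (fun a : K => ‖a‖) :=
  fun a b => IsUltrametricDist.norm_add_le_max a b

omit [IsUltrametricDist K] in
lemma radii_nonneg (π : K) (r : Fin n → ℚ) : 0 ≤ radii π r :=
  fun _ => Real.rpow_nonneg (norm_nonneg _) _

/-- The Gauss norm is a norm on the Tate algebra. -/
def Tate.ringNorm (hπ : π ≠ 0) (r : Fin n → ℚ) : RingNorm (Tate π r) where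
  toFun f := gaussNorm π r f
  map_zero' := MvPowerSeries.gaussNorm_zero _ _ norm_zero
  add_le' f g := (MvPowerSeries.gaussNorm_add_le_max _ _ _ _ (radii_nonneg π r) norm_nonneg
    isNonarchimedean_norm (Tate.hasGaussNorm f) (Tate.hasGaussNorm g)).trans
      (max_le_add_of_nonneg (MvPowerSeries.gaussNorm_nonneg _ _ _ norm_nonneg)
        (MvPowerSeries.gaussNorm_nonneg _ _ _ norm_nonneg))
  neg' _ := MvPowerSeries.gaussNorm_neg _ _ norm_neg _
  mul_le' f g := MvPowerSeries.gaussNorm_mul_le _ _ _ _ (radii_nonneg π r) norm_nonneg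
    norm_mul_le isNonarchimedean_norm norm_zero (Tate.hasGaussNorm f) (Tate.hasGaussNorm g)
  eq_zero_of_map_eq_zero' f hf := Subtype.ext <|
    (MvPowerSeries.gaussNorm_eq_zero_iff _ _ _ norm_zero norm_nonneg (fun _ => norm_eq_zero.mp)
      (radii_pos hπ r) (Tate.hasGaussNorm f)).mp hf

/-- A nonzero π makes all radii positive, which definiteness of the norm requires; `Fact` lets
instance search supply this. -/
instance [Fact (π ≠ 0)] : NormedCommRing (Tate π r) :=
  { RingNorm.toNormedRing (Tate.ringNorm (Fact.out : π ≠ 0) r) with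
    mul_comm := mul_comm }

variable [Fact (π ≠ 0)]

lemma Tate.norm_def (f : Tate π r) : ‖f‖ = gaussNorm π r f := rfl

omit [IsUltrametricDist K] in
lemma Tate.weight_pos (k : Fin n →₀ ℕ) : 0 < weight (radii π r) k :=
  TateFGLM.weight_pos (radii_pos Fact.out r) k

lemma Tate.norm_coeff_le (f : Tate π r) (k : Fin n →₀ ℕ) :
    ‖Tate.coeff k f‖ * weight (radii π r) k ≤ ‖f‖ :=
  MvPowerSeries.le_gaussNorm _ _ _ (Tate.hasGaussNorm f) k

lemma Tate.norm_le {f : Tate π r} {c : ℝ}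
    (h : ∀ k, ‖Tate.coeff k f‖ * weight (radii π r) k ≤ c) : ‖f‖ ≤ c :=
  ciSup_le h

instance : IsUltrametricDist (Tate π r) :=
  IsUltrametricDist.isUltrametricDist_of_forall_norm_add_le_max_norm fun f g =>
    MvPowerSeries.gaussNorm_add_le_max _ _ _ _ (radii_nonneg π r) norm_nonneg
      isNonarchimedean_norm (Tate.hasGaussNorm f) (Tate.hasGaussNorm g)

instance [CompleteSpace K] : CompleteSpace (Tate π r) := by
  refine Metric.complete_of_cauchySeq_tendsto fun f hf => ?_
  have hcoeff : ∀ k, CauchySeq fun j => Tate.coeff k (f j) := by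
    intro k
    rw [Metric.cauchySeq_iff] at hf ⊢
    intro ε hε
    obtain ⟨N, hN⟩ := hf (ε * weight (radii π r) k) (mul_pos hε (Tate.weight_pos k))
    refine ⟨N, fun i hi j hj => ?_⟩
    rw [dist_eq_norm, ← map_sub]
    refine lt_of_mul_lt_mul_right ?_ (Tate.weight_pos (π := π) (r := r) k).le
    refine (Tate.norm_coeff_le _ k).trans_lt ?_
    rw [← dist_eq_norm]
    exact hN i hi j hj
  choose a ha using fun k => cauchySeq_tendsto_of_complete (hcoeff k)
  -- The Cauchy bound passes to the coefficientwise limit uniformly in `k`. This gives both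
  -- membership of the limit in the algebra and convergence in norm.
  have key : ∀ ε > 0, ∃ N, ∀ j ≥ N, ∀ k,
      ‖Tate.coeff k (f j) - a k‖ * weight (radii π r) k ≤ ε := by
    intro ε hε
    obtain ⟨N, hN⟩ := Metric.cauchySeq_iff.mp hf ε hε
    refine ⟨N, fun j hj k => ?_⟩
    have hlim : Filter.Tendsto (fun i => ‖Tate.coeff k (f j) - Tate.coeff k (f i)‖ *
        weight (radii π r) k) Filter.atTop
        (nhds (‖Tate.coeff k (f j) - a k‖ * weight (radii π r) k)) :=
      ((tendsto_const_nhds.sub (ha k)).norm).mul_const _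
    refine le_of_tendsto hlim (Filter.eventually_atTop.mpr ⟨N, fun i hi => ?_⟩)
    rw [← map_sub]
    refine (Tate.norm_coeff_le _ k).trans ?_
    rw [← dist_eq_norm]
    exact (hN j hj i hi).le
  have hmem : MvPowerSeries.IsRestricted (radii π r) (fun k => a k : MvPowerSeries (Fin n) K) := by
    change Filter.Tendsto (fun k => ‖a k‖ * weight (radii π r) k) Filter.cofinite (nhds 0)
    rw [Metric.tendsto_nhds]
    intro ε hε
    obtain ⟨N, hN⟩ := key (ε / 2) (half_pos hε)
    filter_upwards [Metric.tendsto_nhds.mp (Tate.tendsto_coeff (f N)) ε hε] with k hk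
    have hw := (Tate.weight_pos (π := π) (r := r) k).le
    rw [dist_zero_right, Real.norm_of_nonneg (mul_nonneg (norm_nonneg _) hw)] at hk ⊢
    have h1 : ‖a k‖ ≤ max ‖Tate.coeff k (f N)‖ ‖Tate.coeff k (f N) - a k‖ := by
      simpa [norm_sub_rev] using
        IsUltrametricDist.norm_add_le_max (Tate.coeff k (f N)) (a k - Tate.coeff k (f N))
    refine (mul_le_mul_of_nonneg_right h1 hw).trans_lt ?_
    rw [max_mul_of_nonneg _ _ hw]
    exact max_lt hk ((hN N le_rfl k).trans_lt (half_lt_self hε))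
  refine ⟨⟨_, hmem⟩, Metric.tendsto_atTop.mpr fun ε hε => ?_⟩
  obtain ⟨N, hN⟩ := key (ε / 2) (half_pos hε)
  refine ⟨N, fun j hj => ?_⟩
  rw [dist_eq_norm]
  refine (Tate.norm_le fun k => ?_).trans_lt (half_lt_self hε)
  rw [map_sub]
  exact hN j hj k

end NormedTate

/-! ### Monomials and truncations -/

section Monomials

variable {K : Type*} [NormedField K] [IsUltrametricDist K] {n : ℕ} {π : K} {r : Fin n → ℚ}

/-- The monomial `X ^ k` of the Tate algebra. -/
def Tate.monomial (π : K) (r : Fin n → ℚ) (k : Fin n →₀ ℕ) : Tate π r :=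
  ⟨MvPowerSeries.monomial k 1, MvPowerSeries.isRestricted_monomial (radii π r) _ _⟩

lemma Tate.monomial_add (k l : Fin n →₀ ℕ) :
    Tate.monomial π r (k + l) = Tate.monomial π r k * Tate.monomial π r l :=
  Subtype.ext (by simp [Tate.monomial, MvPowerSeries.monomial_mul_monomial])

lemma Tate.monomial_single (i : Fin n) (j : ℕ) :
    Tate.monomial π r (Finsupp.single i j) = Tate.X π r i ^ j :=
  Subtype.ext (by simp [Tate.monomial, Tate.X, MvPowerSeries.X_pow_eq])

open Classical in
lemma Tate.coeff_monomial (k l : Fin n →₀ ℕ) :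
    Tate.coeff k (Tate.monomial π r l) = if k = l then 1 else 0 :=
  MvPowerSeries.coeff_monomial k l 1

/-- The part of a power series that is supported on a finite set of exponents. -/
def Tate.truncate (s : Finset (Fin n →₀ ℕ)) (f : Tate π r) : Tate π r :=
  ∑ k ∈ s, Tate.coeff k f • Tate.monomial π r k

open Classical in
lemma Tate.coeff_truncate (s : Finset (Fin n →₀ ℕ)) (f : Tate π r) (k : Fin n →₀ ℕ) :
    Tate.coeff k (Tate.truncate s f) = if k ∈ s then Tate.coeff k f else 0 := by
  simp [Tate.truncate, Tate.coeff_monomial]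

lemma Tate.norm_smul_monomial [Fact (π ≠ 0)] (a : K) (k : Fin n →₀ ℕ) :
    ‖a • Tate.monomial π r k‖ ≤ ‖a‖ * weight (radii π r) k := by
  classical
  refine Tate.norm_le fun l => ?_
  rw [map_smul, Tate.coeff_monomial]
  split_ifs with h
  · simp [h]
  · simpa using mul_nonneg (norm_nonneg a) (Tate.weight_pos (π := π) (r := r) k).le

lemma Tate.exists_norm_sub_truncate_le [Fact (π ≠ 0)] (f : Tate π r) {ε : ℝ} (hε : 0 < ε) :
    ∃ s, ‖f - Tate.truncate s f‖ ≤ ε := by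
  classical
  have h := Metric.tendsto_nhds.mp (Tate.tendsto_coeff f) ε hε
  rw [Filter.eventually_cofinite] at h
  refine ⟨h.toFinset, Tate.norm_le fun k => ?_⟩
  rw [map_sub, Tate.coeff_truncate]
  split_ifs with hk
  · simpa using hε.le
  · rw [Set.Finite.mem_toFinset, Set.mem_ofPred_eq, not_not, dist_zero_right] at hk
    rw [sub_zero]
    exact (le_abs_self _).trans hk.le

end Monomials

/-! ### Polynomials with a dominant constant or leading coefficient -/

section Coefficients

variable {F : Type*} [NormedField F] [IsUltrametricDist F] {ρ : ℝ}

/-- The constant coefficient of `P` strictly dominates the other ones at radius `ρ`. -/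
def HasDominantConstant (ρ : ℝ) (P : F[X]) : Prop :=
  ∀ j ≠ 0, ‖P.coeff j‖ * ρ ^ j < ‖P.coeff 0‖

/-- `P` is monic and its leading coefficient dominates the other ones at radius `ρ`. -/
def HasDominantLead (ρ : ℝ) (P : F[X]) : Prop :=
  P.Monic ∧ ∀ j, ‖P.coeff j‖ * ρ ^ j ≤ ρ ^ P.natDegree

omit [IsUltrametricDist F] in
lemma HasDominantConstant.coeff_zero_ne_zero (hρ : 0 ≤ ρ) {P : F[X]}
    (hP : HasDominantConstant ρ P) : P.coeff 0 ≠ 0 :=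
  norm_pos_iff.mp ((mul_nonneg (norm_nonneg _) (pow_nonneg hρ _)).trans_lt (hP 1 one_ne_zero))

omit [IsUltrametricDist F] in
lemma HasDominantConstant.le {P : F[X]} (hP : HasDominantConstant ρ P) (j : ℕ) :
    ‖P.coeff j‖ * ρ ^ j ≤ ‖P.coeff 0‖ := by
  rcases eq_or_ne j 0 with rfl | hj
  · simp
  · exact (hP j hj).le

/-- An ultrametric sum is bounded by one of its terms, here applied to the convolution formula. -/
lemma exists_norm_coeff_mul_le (P Q : F[X]) (j : ℕ) : ∃ a b, a + b = j ∧
    ‖(P * Q).coeff j‖ ≤ ‖P.coeff a‖ * ‖Q.coeff b‖ := by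
  obtain ⟨p, hp, h⟩ := IsUltrametricDist.exists_norm_finsetSum_le_of_nonempty
    (t := Finset.HasAntidiagonal.antidiagonal j)
    ⟨(0, j), Finset.HasAntidiagonal.mem_antidiagonal.mpr (zero_add j)⟩
    fun p => P.coeff p.1 * Q.coeff p.2
  refine ⟨p.1, p.2, Finset.HasAntidiagonal.mem_antidiagonal.mp hp, ?_⟩
  rwa [← norm_mul, coeff_mul]

/-- When `a + b ≠ 0`, at least one of the two factors is strictly smaller than its constant
coefficient, and both constant coefficients are nonzero. -/
lemma HasDominantConstant.mul (hρ : 0 ≤ ρ) {P Q : F[X]} (hP : HasDominantConstant ρ P)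
    (hQ : HasDominantConstant ρ Q) : HasDominantConstant ρ (P * Q) := by
  intro j hj
  obtain ⟨a, b, rfl, h⟩ := exists_norm_coeff_mul_le P Q j
  rw [mul_coeff_zero, norm_mul]
  refine (mul_le_mul_of_nonneg_right h (pow_nonneg hρ _)).trans_lt ?_
  rw [pow_add, mul_mul_mul_comm]
  have hP0 := norm_pos_iff.mpr (hP.coeff_zero_ne_zero hρ)
  have hQ0 := norm_pos_iff.mpr (hQ.coeff_zero_ne_zero hρ)
  rcases eq_or_ne a 0 with rfl | ha
  · exact mul_lt_mul' (hP.le 0) (hQ b (by simpa using hj))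
      (mul_nonneg (norm_nonneg _) (pow_nonneg hρ _)) hP0
  · exact mul_lt_mul_of_lt_of_le_of_nonneg_of_pos (hP a ha) (hQ.le b)
      (mul_nonneg (norm_nonneg _) (pow_nonneg hρ _)) hQ0

lemma HasDominantLead.mul (hρ : 0 ≤ ρ) {P Q : F[X]} (hP : HasDominantLead ρ P)
    (hQ : HasDominantLead ρ Q) : HasDominantLead ρ (P * Q) := by
  refine ⟨hP.1.mul hQ.1, fun j => ?_⟩
  obtain ⟨a, b, rfl, h⟩ := exists_norm_coeff_mul_le P Q j
  rw [hP.1.natDegree_mul hQ.1, pow_add ρ P.natDegree]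
  refine (mul_le_mul_of_nonneg_right h (pow_nonneg hρ _)).trans ?_
  rw [pow_add, mul_mul_mul_comm]
  exact mul_le_mul (hP.2 a) (hQ.2 b) (mul_nonneg (norm_nonneg _) (pow_nonneg hρ _))
    (pow_nonneg hρ _)

omit [IsUltrametricDist F] in
lemma hasDominantConstant_X_sub_C {x : F} (hx : ρ < ‖x‖) (hρ : 0 ≤ ρ) :
    HasDominantConstant ρ (X - C x) := by
  intro j hj
  rcases j with _ | _ | j
  · exact absurd rfl hj
  · simpa [coeff_X, coeff_C] using hx
  · simpa [coeff_X, coeff_C] using hρ.trans_lt hx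

omit [IsUltrametricDist F] in
lemma hasDominantLead_X_sub_C {x : F} (hx : ‖x‖ ≤ ρ) : HasDominantLead ρ (X - C x) := by
  refine ⟨monic_X_sub_C x, fun j => ?_⟩
  rw [natDegree_X_sub_C, pow_one]
  rcases j with _ | _ | j
  · simpa [coeff_X, coeff_C] using hx
  · simp [coeff_X]
  · simpa [coeff_X, coeff_C] using (norm_nonneg x).trans hx

lemma hasDominantConstant_prod (hρ : 0 ≤ ρ) (S : Multiset F) (hS : ∀ x ∈ S, ρ < ‖x‖) :
    HasDominantConstant ρ (S.map fun x => X - C x).prod := by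
  induction S using Multiset.induction_on with
  | empty =>
    intro j hj
    simp [coeff_one, hj]
  | cons x S ih =>
    rw [Multiset.map_cons, Multiset.prod_cons]
    exact (hasDominantConstant_X_sub_C (hS x (Multiset.mem_cons_self x S)) hρ).mul hρ
      (ih fun y hy => hS y (Multiset.mem_cons_of_mem hy))

lemma hasDominantLead_prod (hρ : 0 ≤ ρ) (S : Multiset F) (hS : ∀ x ∈ S, ‖x‖ ≤ ρ) :
    HasDominantLead ρ (S.map fun x => X - C x).prod := by
  induction S using Multiset.induction_on with
  | empty =>
    refine ⟨monic_one, fun j => ?_⟩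
    rcases eq_or_ne j 0 with rfl | hj
    · simp
    · simp [coeff_one, hj]
  | cons x S ih =>
    rw [Multiset.map_cons, Multiset.prod_cons]
    exact (hasDominantLead_X_sub_C (hS x (Multiset.mem_cons_self x S))).mul hρ
      (ih fun y hy => hS y (Multiset.mem_cons_of_mem hy))

end Coefficients

/-! ### Dominance for the two slope factors -/

section SlopeFactors

variable {K : Type*} [NontriviallyNormedField K] [IsUltrametricDist K] [CompleteSpace K]
  (π : K) (s : ℝ)

-- The spectral norm makes the algebraic closure an ultrametric field extending `K`. There both
-- factors split into linear factors X - x, with ‖x‖ > ρ or ‖x‖ ≤ ρ, and dominance is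
-- multiplicative. It descends because coefficients keep their norms.
open Classical in
lemma bigFactor_dominant {χ : K[X]} (hχ : χ.Monic) :
    HasDominantConstant (‖π‖ ^ s) (bigFactor π s χ) ∧
    ∃ g : K[X], χ = bigFactor π s χ * g ∧ HasDominantLead (‖π‖ ^ s) g := by
  have hρ : 0 ≤ ‖π‖ ^ s := Real.rpow_nonneg (norm_nonneg _) _
  let _ : NormedField (AlgebraicClosure K) := spectralNorm.normedField K (AlgebraicClosure K)
  have hult : IsUltrametricDist (AlgebraicClosure K) :=
    IsUltrametricDist.isUltrametricDist_of_isNonarchimedean_norm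
      (isNonarchimedean_spectralNorm (K := K) (L := AlgebraicClosure K))
  have hnorm : ∀ a : K, ‖algebraMap K (AlgebraicClosure K) a‖ = ‖a‖ := spectralNorm_extends
  have hcoeff : ∀ (P : K[X]) j, ‖(P.map (algebraMap K (AlgebraicClosure K))).coeff j‖ =
      ‖P.coeff j‖ := fun P j => by rw [coeff_map, hnorm]
  have hbig := map_bigFactor π s hχ
  have h1 := hasDominantConstant_prod hρ
    ((χ.aroots (AlgebraicClosure K)).filter (IsBigRoot π s)) fun x hx =>
      (Multiset.mem_filter.mp hx).2
  have h2 := hasDominantLead_prod hρ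
    ((χ.aroots (AlgebraicClosure K)).filter fun x => ¬ IsBigRoot π s x) fun x hx =>
      not_lt.mp (Multiset.mem_filter.mp hx).2
  rw [← hbig] at h1
  refine ⟨fun j hj => by simpa only [hcoeff] using h1 j hj, ?_⟩
  obtain ⟨g, hg⟩ : bigFactor π s χ ∣ χ := by
    have hle : (UniqueFactorizationMonoid.normalizedFactors χ).filter (fun P =>
        ∃ x ∈ P.aroots (AlgebraicClosure K), IsBigRoot π s x) ≤
        UniqueFactorizationMonoid.normalizedFactors χ := Multiset.filter_le _ _
    refine (Multiset.prod_dvd_prod_of_le hle).trans ?_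
    exact (UniqueFactorizationMonoid.prod_normalizedFactors_eq hχ.ne_zero).dvd.trans
      (normalize_associated χ).dvd
  have hmap : χ.map (algebraMap K (AlgebraicClosure K)) =
      ((χ.aroots (AlgebraicClosure K)).map fun x => X - C x).prod :=
    (IsAlgClosed.splits _).eq_prod_roots_of_monic (hχ.map _)
  have hgmap : g.map (algebraMap K (AlgebraicClosure K)) =
      (((χ.aroots (AlgebraicClosure K)).filter fun x => ¬ IsBigRoot π s x).map
        fun x => X - C x).prod := by
    -- The cofactor is identified by cancelling the big factor from the full product over the roots.
    have h0 : (bigFactor π s χ).map (algebraMap K (AlgebraicClosure K)) ≠ 0 := by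
      intro h0
      rw [hg, Polynomial.map_mul, h0, zero_mul] at hmap
      exact (hχ.map (algebraMap K (AlgebraicClosure K))).ne_zero
        (by rw [hg, Polynomial.map_mul, h0, zero_mul])
    refine mul_left_cancel₀ h0 ?_
    rw [← Polynomial.map_mul, ← hg, hmap, hbig, ← Multiset.prod_add, ← Multiset.map_add,
      Multiset.filter_add_not]
  rw [← hgmap] at h2
  refine ⟨g, hg, ?_, fun j => ?_⟩
  · exact monic_of_injective (algebraMap K (AlgebraicClosure K)).injective h2.1
  · simpa only [hcoeff, natDegree_map] using h2.2 j

end SlopeFactors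

/-! ### Units from dominant constants -/

section Units

variable {K : Type*} [NormedField K] [IsUltrametricDist K] [CompleteSpace K] {n : ℕ} {π : K}
  {r : Fin n → ℚ} [Fact (π ≠ 0)]

/-- Write Q(X_i) = Q(0)(1 - t). Strict dominance gives ‖t‖ < 1, so the geometric series inverts 1 -
t. -/
lemma Tate.isUnit_aeval_X (i : Fin n) {Q : K[X]}
    (hQ : HasDominantConstant (radii π r i) Q) : IsUnit (aeval (Tate.X π r i) Q) := by
  have hρ := radii_pos (Fact.out : π ≠ 0) r i
  have h0 := hQ.coeff_zero_ne_zero hρ.le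
  set t : Tate π r :=
    ∑ j ∈ Finset.range Q.natDegree, (-(Q.coeff 0)⁻¹ * Q.coeff (j + 1)) • Tate.X π r i ^ (j + 1)
    with ht
  have heq : aeval (Tate.X π r i) Q = Q.coeff 0 • (1 - t) := by
    have hj : ∀ j, Q.coeff 0 * (-(Q.coeff 0)⁻¹ * Q.coeff (j + 1)) = -Q.coeff (j + 1) := fun j => by
      rw [neg_mul, mul_neg, mul_inv_cancel_left₀ h0]
    rw [aeval_eq_sum_range, Finset.sum_range_succ', smul_sub, ht, Finset.smul_sum]
    simp only [smul_smul, hj, pow_zero, neg_smul, Finset.sum_neg_distrib, sub_neg_eq_add]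
    rw [add_comm]
  have hlt : ‖t‖ < 1 := by
    rcases (Finset.range Q.natDegree).eq_empty_or_nonempty with h | h
    · rw [ht, h, Finset.sum_empty, norm_zero]
      exact one_pos
    obtain ⟨j, -, hj⟩ := IsUltrametricDist.exists_norm_finsetSum_le_of_nonempty h fun j =>
      (-(Q.coeff 0)⁻¹ * Q.coeff (j + 1)) • Tate.X π r i ^ (j + 1)
    refine hj.trans_lt ?_
    rw [← Tate.monomial_single]
    refine (Tate.norm_smul_monomial _ _).trans_lt ?_
    rw [weight_single, norm_mul, norm_neg, norm_inv, mul_assoc,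
      inv_mul_lt_one₀ (norm_pos_iff.mpr h0)]
    exact hQ _ j.succ_ne_zero
  rw [heq, Algebra.smul_def]
  exact ((IsUnit.mk0 _ h0).map _).mul (isUnit_one_sub_of_norm_lt_one hlt)

end Units

/-! ### Scaling in a discretely valued field -/

section Uniformizer

variable {K : Type*} [NormedField K] {π : K}

lemma IsUniformizer.norm_pos (hπ : IsUniformizer π) : 0 < ‖π‖ := norm_pos_iff.mpr hπ.ne_zero

/-- The witness is the power of `π` whose norm is the largest value at most `c`. It serves to
normalize vectors at the cost of a factor at most ‖π‖⁻¹, and to generate the fractional ideal of all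
`a` with ‖a‖ ≤ c. -/
lemma IsUniformizer.exists_max_norm_le (hπ : IsUniformizer π) {c : ℝ} (hc : 0 < c) :
    ∃ b : K, b ≠ 0 ∧ ‖b‖ ≤ c ∧ c * ‖π‖ < ‖b‖ ∧ ∀ a : K, ‖a‖ ≤ c → ‖a‖ ≤ ‖b‖ := by
  have hy : 1 < ‖π‖⁻¹ := (one_lt_inv₀ hπ.norm_pos).mpr hπ.norm_lt_one
  obtain ⟨m, hm, hm'⟩ := exists_mem_Ico_zpow hc hy
  have hb : ‖π ^ (-m)‖ = ‖π‖⁻¹ ^ m := by rw [norm_zpow, zpow_neg, inv_zpow]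
  refine ⟨π ^ (-m), zpow_ne_zero _ hπ.ne_zero, hb.trans_le hm, ?_, fun a ha => ?_⟩
  · rw [hb]
    rwa [zpow_add_one₀ (by positivity), ← div_eq_mul_inv, lt_div_iff₀ hπ.norm_pos] at hm'
  · rcases eq_or_ne a 0 with rfl | ha0
    · rw [norm_zero]
      exact norm_nonneg _
    obtain ⟨k, hk⟩ := hπ.discrete a ha0
    have hk' : ‖a‖ = ‖π‖⁻¹ ^ (-k) := by rw [hk, inv_zpow, zpow_neg, inv_inv]
    rw [hk'] at ha
    rw [hb, hk']
    exact zpow_le_zpow_right₀ hy.le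
      (Int.lt_add_one_iff.mp ((zpow_lt_zpow_iff_right₀ hy).mp (ha.trans_lt hm')))

end Uniformizer

/-- If the weighted relations given by the polynomials `g_i` hold modulo `M`, then `M`
contains all weighted multiples of a family as soon as it contains those with small exponents. -/
lemma smul_mem_of_reduction {K E : Type*} [NormedField K] [AddCommGroup E] [Module K E] {n : ℕ}
    (M : AddSubgroup E) {ρ : Fin n → ℝ} (hρ : ∀ i, 0 < ρ i) (e : (Fin n →₀ ℕ) → E)
    (g : Fin n → K[X]) (hg : ∀ i, HasDominantLead (ρ i) (g i))
    (hbox : ∀ k, (∀ i, k i < (g i).natDegree) → ∀ a : K, ‖a‖ * weight ρ k ≤ 1 → a • e k ∈ M)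
    (hrel : ∀ k i (a : K), ‖a‖ * weight ρ (k + Finsupp.single i (g i).natDegree) ≤ 1 →
      ∑ j ∈ Finset.range ((g i).natDegree + 1),
        (a * (g i).coeff j) • e (k + Finsupp.single i j) ∈ M)
    (k : Fin n →₀ ℕ) (a : K) (ha : ‖a‖ * weight ρ k ≤ 1) : a • e k ∈ M := by
  induction hd : k.degree using Nat.strong_induction_on generalizing k a with
  | _ d ih =>
    by_cases hk : ∀ i, k i < (g i).natDegree
    · exact hbox k hk a ha
    push Not at hk
    obtain ⟨i, hi⟩ := hk
    obtain ⟨l, rfl⟩ : ∃ l, k = l + Finsupp.single i (g i).natDegree :=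
      ⟨k - Finsupp.single i (g i).natDegree, (tsub_add_cancel_of_le (by
        simpa using hi)).symm⟩
    have h := hrel l i a ha
    rw [Finset.sum_range_succ, (hg i).1.coeff_natDegree, mul_one] at h
    -- The relation trades the leading term for terms of smaller total degree; dominance of the
    -- leading coefficient keeps their weighted norms at most 1.
    refine (M.add_mem_cancel_left (M.sum_mem fun j hj => ?_)).mp h
    have hj' := Finset.mem_range.mp hj
    refine ih (l + Finsupp.single i j).degree ?_ _ _ ?_ rfl
    · rw [← hd, map_add, map_add]
      simpa using hj'
    · refine le_trans ?_ ha
      rw [norm_mul, weight_add, weight_add, weight_single, weight_single, mul_assoc]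
      refine mul_le_mul_of_nonneg_left ?_ (norm_nonneg a)
      rw [mul_left_comm]
      exact mul_le_mul_of_nonneg_left ((hg i).2 j) (weight_pos hρ l).le

/-! ### Division by polynomials in single variables -/

section Division

variable {K : Type*} [NontriviallyNormedField K] [IsUltrametricDist K] {n : ℕ} {π : K}
  {r : Fin n → ℚ}

lemma Tate.monomial_mul_aeval_X (k : Fin n →₀ ℕ) (i : Fin n) (g : K[X]) (a : K) :
    a • Tate.monomial π r k * aeval (Tate.X π r i) g =
      ∑ j ∈ Finset.range (g.natDegree + 1),
        (a * g.coeff j) • Tate.monomial π r (k + Finsupp.single i j) := by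
  rw [aeval_eq_sum_range, Finset.mul_sum]
  refine Finset.sum_congr rfl fun j _ => ?_
  rw [Tate.monomial_add, Tate.monomial_single, smul_mul_smul_comm]

variable [Fact (π ≠ 0)]

instance : NormedSpace K (Tate π r) where
  norm_smul_le a f := Tate.norm_le fun k => by
    rw [map_smul, norm_smul, mul_assoc]
    exact mul_le_mul_of_nonneg_left (Tate.norm_coeff_le f k) (norm_nonneg a)

/-- The power series with finitely many terms. -/
def Tate.polynomials (π : K) (r : Fin n → ℚ) : AddSubgroup (Tate π r) where
  carrier := {f | ∃ s, f = Tate.truncate s f}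
  zero_mem' := ⟨∅, rfl⟩
  add_mem' {f g} := by
    classical
    rintro ⟨s, hs⟩ ⟨t, ht⟩
    refine ⟨s ∪ t, Tate.ext fun k => ?_⟩
    rw [Tate.coeff_truncate]
    split_ifs with h
    · rfl
    rw [Finset.mem_union, not_or] at h
    rw [map_add, hs, ht, Tate.coeff_truncate, Tate.coeff_truncate, if_neg h.1, if_neg h.2,
      add_zero]
  neg_mem' {f} := by
    rintro ⟨s, hs⟩
    refine ⟨s, ?_⟩
    nth_rewrite 1 [hs]
    simp [Tate.truncate]

omit [Fact (π ≠ 0)] in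
lemma Tate.truncate_mem_polynomials (s : Finset (Fin n →₀ ℕ)) (f : Tate π r) :
    Tate.truncate s f ∈ Tate.polynomials π r := by
  classical
  refine ⟨s, Tate.ext fun k => ?_⟩
  simp +contextual [Tate.coeff_truncate]

lemma Tate.topologicalClosure_polynomials :
    (Tate.polynomials π r).topologicalClosure = ⊤ := by
  refine eq_top_iff.mpr fun f _ => ?_
  change f ∈ closure (Tate.polynomials π r : Set (Tate π r))
  rw [Metric.mem_closure_iff]
  intro ε hε
  obtain ⟨s, hs⟩ := Tate.exists_norm_sub_truncate_le f (half_pos hε)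
  refine ⟨_, Tate.truncate_mem_polynomials s f, ?_⟩
  rw [dist_eq_norm]
  exact hs.trans_lt (half_lt_self hε)

/-- The sum of multiples of `g_i(X_i)` and of terms with exponents in `s`. -/
def Tate.recombine (π : K) (r : Fin n → ℚ) (g : Fin n → K[X]) (s : Finset (Fin n →₀ ℕ)) :
    (Fin n → Tate π r) × (s → K) →ₗ[K] Tate π r :=
  LinearMap.coprod
    (∑ i, (LinearMap.mulRight K (aeval (Tate.X π r i) (g i))).comp (LinearMap.proj i))
    (∑ k : s, (LinearMap.toSpanSingleton K _ (Tate.monomial π r k)).comp (LinearMap.proj k))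

omit [Fact (π ≠ 0)] in
lemma Tate.recombine_apply (g : Fin n → K[X]) (s : Finset (Fin n →₀ ℕ))
    (x : (Fin n → Tate π r) × (s → K)) :
    Tate.recombine π r g s x =
      ∑ i, x.1 i * aeval (Tate.X π r i) (g i) + ∑ k, x.2 k • Tate.monomial π r k := by
  simp [Tate.recombine]

lemma Tate.exists_norm_recombine_le (g : Fin n → K[X]) (s : Finset (Fin n →₀ ℕ)) :
    ∃ C, ∀ x, ‖Tate.recombine π r g s x‖ ≤ C * ‖x‖ := by
  refine ⟨∑ i, ‖aeval (Tate.X π r i) (g i)‖ + ∑ k : s, ‖Tate.monomial π r k‖, fun x => ?_⟩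
  rw [Tate.recombine_apply, add_mul, Finset.sum_mul, Finset.sum_mul]
  refine (norm_add_le _ _).trans (add_le_add
    ((norm_sum_le _ _).trans (Finset.sum_le_sum fun i _ => ?_))
    ((norm_sum_le _ _).trans (Finset.sum_le_sum fun k _ => ?_)))
  · refine (norm_mul_le _ _).trans ?_
    rw [mul_comm]
    exact mul_le_mul_of_nonneg_left ((norm_le_pi_norm _ i).trans (norm_fst_le x)) (norm_nonneg _)
  · refine (norm_smul_le _ _).trans ?_
    rw [mul_comm]
    exact mul_le_mul_of_nonneg_left ((norm_le_pi_norm _ k).trans (norm_snd_le x)) (norm_nonneg _)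

/-- For fixed `C`, the elements with a preimage of norm at most `C` form a subgroup, by the
ultrametric inequality. Reduction of exponents therefore applies, and the bound does not grow with
the number of terms or of reduction steps. -/
lemma Tate.exists_recombine_monomial (g : Fin n → K[X])
    (hg : ∀ i, HasDominantLead (radii π r i) (g i)) (s : Finset (Fin n →₀ ℕ))
    (hs : ∀ k, (∀ i, k i < (g i).natDegree) → k ∈ s) :
    ∃ C, 0 < C ∧ ∀ f ∈ Tate.polynomials π r, ‖f‖ ≤ 1 →
      ∃ x, Tate.recombine π r g s x = f ∧ ‖x‖ ≤ C := by
  classical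
  have hρ := radii_pos (Fact.out : π ≠ 0) r
  have hw := fun k => Tate.weight_pos (π := π) (r := r) k
  -- The two sums bound, respectively, a coefficient in the box and the quotient produced by one
  -- reduction.
  set C : ℝ := 1 + ∑ k ∈ s, (weight (radii π r) k)⁻¹ + ∑ i, (radii π r i ^ (g i).natDegree)⁻¹
    with hC
  have hpos1 : 0 ≤ ∑ k ∈ s, (weight (radii π r) k)⁻¹ :=
    Finset.sum_nonneg fun k _ => (inv_pos.mpr (hw k)).le
  have hpos2 : 0 ≤ ∑ i, (radii π r i ^ (g i).natDegree)⁻¹ :=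
    Finset.sum_nonneg fun i _ => (inv_pos.mpr (pow_pos (hρ i) _)).le
  have hC1 : ∀ k ∈ s, (weight (radii π r) k)⁻¹ ≤ C := fun k hk => by
    have := Finset.single_le_sum (f := fun k => (weight (radii π r) k)⁻¹)
      (fun k _ => (inv_pos.mpr (hw k)).le) hk
    linarith
  have hC2 : ∀ i, (radii π r i ^ (g i).natDegree)⁻¹ ≤ C := fun i => by
    have := Finset.single_le_sum (f := fun i => (radii π r i ^ (g i).natDegree)⁻¹)
      (fun i _ => (inv_pos.mpr (pow_pos (hρ i) _)).le) (Finset.mem_univ i)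
    linarith
  have hC0 : 0 < C := by linarith
  let M : AddSubgroup (Tate π r) :=
    { carrier := {f | ∃ x, Tate.recombine π r g s x = f ∧ ‖x‖ ≤ C}
      zero_mem' := ⟨0, map_zero _, by simpa using hC0.le⟩
      add_mem' := by
        rintro _ _ ⟨x, rfl, hx⟩ ⟨y, rfl, hy⟩
        rw [norm_prod_le_iff, pi_norm_le_iff_of_nonneg hC0.le,
          pi_norm_le_iff_of_nonneg hC0.le] at hx hy
        refine ⟨x + y, map_add _ _ _, ?_⟩
        rw [norm_prod_le_iff, pi_norm_le_iff_of_nonneg hC0.le, pi_norm_le_iff_of_nonneg hC0.le]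
        exact ⟨fun i => (IsUltrametricDist.norm_add_le_max _ _).trans (max_le (hx.1 i) (hy.1 i)),
          fun k => (IsUltrametricDist.norm_add_le_max _ _).trans (max_le (hx.2 k) (hy.2 k))⟩
      neg_mem' := by
        rintro _ ⟨x, rfl, hx⟩
        exact ⟨-x, map_neg _ _, by rwa [norm_neg]⟩ }
  refine ⟨C, hC0, fun f hf hf1 => ?_⟩
  obtain ⟨t, ht⟩ := hf
  change f ∈ M
  rw [ht]
  refine M.sum_mem fun k _ => ?_
  refine smul_mem_of_reduction M hρ (Tate.monomial π r) g hg ?_ ?_ k _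
    ((Tate.norm_coeff_le f k).trans hf1)
  · intro k hk a ha
    refine ⟨(0, Pi.single ⟨k, hs k hk⟩ a), ?_, ?_⟩
    · rw [Tate.recombine_apply]
      simp [Pi.single_apply, ite_smul]
    · rw [Prod.norm_mk, norm_zero, Pi.norm_single]
      refine max_le hC0.le (le_trans ?_ (hC1 k (hs k hk)))
      rwa [← one_div, le_div_iff₀ (hw k)]
  · intro k i a ha
    refine ⟨(Pi.single i (a • Tate.monomial π r k), 0), ?_, ?_⟩
    · rw [Tate.recombine_apply, ← Tate.monomial_mul_aeval_X]
      simp [Pi.single_apply, ite_mul]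
    · rw [Prod.norm_mk, norm_zero, Pi.norm_single]
      refine max_le (le_trans ?_ (hC2 i)) hC0.le
      refine (Tate.norm_smul_monomial _ _).trans ?_
      rw [weight_add, weight_single, ← mul_assoc] at ha
      rwa [← one_div, le_div_iff₀ (pow_pos (hρ i) _)]

/-- Division of restricted power series by polynomials `g_i(X_i)`, with control of the
remainder. -/
theorem Tate.exists_remainder [CompleteSpace K] (hπ : IsUniformizer π) (g : Fin n → K[X])
    (hg : ∀ i, HasDominantLead (radii π r i) (g i)) :
    ∃ (s : Finset (Fin n →₀ ℕ)) (C : ℝ), 0 < C ∧ ∀ f : Tate π r,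
      ∃ x, Tate.recombine π r g s x = f ∧ ‖x‖ ≤ C * ‖f‖ := by
  classical
  set s : Finset (Fin n →₀ ℕ) :=
    Finset.Iic (Finsupp.equivFunOnFinite.symm fun i => (g i).natDegree)
  obtain ⟨C, hC, h⟩ := Tate.exists_recombine_monomial g hg s fun k hk =>
    Finset.mem_Iic.mpr fun i => (hk i).le
  obtain ⟨B, hB⟩ := Tate.exists_norm_recombine_le (π := π) (r := r) g s
  let φ : NormedAddGroupHom ((Fin n → Tate π r) × (s → K)) (Tate π r) :=
    (Tate.recombine π r g s).toAddMonoidHom.mkNormedAddGroupHom B hB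
  have hsurj : φ.SurjectiveOnWith (Tate.polynomials π r) (C * ‖π‖⁻¹) := by
    intro f hf
    rcases eq_or_ne f 0 with rfl | hf0
    · exact ⟨0, map_zero _, by simp⟩
    have hfpos := norm_pos_iff.mpr hf0
    -- Rescaling brings `f` into the unit ball; undoing it accounts for the factor ‖π‖⁻¹ in the
    -- constant.
    obtain ⟨b, hb0, hb1, hb2, -⟩ := hπ.exists_max_norm_le (inv_pos.mpr hfpos)
    have hbf : b • f ∈ Tate.polynomials π r := by
      obtain ⟨t, ht⟩ := hf
      refine ⟨t, ?_⟩
      nth_rewrite 1 [ht]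
      simp [Tate.truncate, Finset.smul_sum, mul_smul]
    obtain ⟨x, hx, hxC⟩ := h (b • f) hbf (by
      rw [norm_smul]
      rwa [← one_div, le_div_iff₀ hfpos] at hb1)
    refine ⟨b⁻¹ • x, ?_, ?_⟩
    · change Tate.recombine π r g s (b⁻¹ • x) = f
      rw [map_smul, hx, inv_smul_smul₀ hb0]
    · rw [norm_smul, norm_inv, mul_comm, mul_assoc]
      refine mul_le_mul hxC ?_ (inv_nonneg.mpr (norm_nonneg _)) hC.le
      rw [inv_le_comm₀ (norm_pos_iff.mpr hb0) (mul_pos (inv_pos.mpr hπ.norm_pos) hfpos), mul_inv,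
        inv_inv, mul_comm]
      exact hb2.le
  have hC' : 0 < C * ‖π‖⁻¹ := mul_pos hC (inv_pos.mpr hπ.norm_pos)
  refine ⟨s, C * ‖π‖⁻¹ + 1, add_pos hC' one_pos, fun f => ?_⟩
  -- Successive approximation: in a complete source, bounded preimages over the dense subgroup of
  -- polynomials extend to its closure, with an arbitrary positive loss in the constant (here 1).
  exact controlled_closure_of_complete hC' one_pos hsurj f
    (Tate.topologicalClosure_polynomials (π := π) (r := r) ▸ AddSubgroup.mem_top f)

end Division

/-! ### The lattice of terms in W' -/

section Quotient

lemma mem_Big_iff {K V : Type*} [NormedField K] [AddCommGroup V] [Module K V]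
    [Module.Finite K V] {π : K} {s : ℝ} {f : Module.End K V} {x : V} :
    x ∈ Big π s f ↔ aeval f (bigFactor π s f.charpoly) x = 0 := Iff.rfl

lemma exists_bigFactor_mul_eq_zero {K V : Type*} [NontriviallyNormedField K] [IsUltrametricDist K]
    [CompleteSpace K] [AddCommGroup V] [Module K V] [Module.Finite K V] (π : K) (s : ℝ)
    (f : Module.End K V) : HasDominantConstant (‖π‖ ^ s) (bigFactor π s f.charpoly) ∧
      ∃ g : K[X], HasDominantLead (‖π‖ ^ s) g ∧
        ∀ x, aeval f (bigFactor π s f.charpoly * g) x = 0 := by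
  obtain ⟨hQ, g, hg, hlead⟩ := bigFactor_dominant π s f.charpoly_monic
  refine ⟨hQ, g, hlead, fun x => ?_⟩
  rw [← hg, LinearMap.aeval_self_charpoly, LinearMap.zero_apply]

variable {K : Type*} [NontriviallyNormedField K] [IsUltrametricDist K] [CompleteSpace K]
  {n : ℕ} {π : K} {r : Fin n → ℚ} (u : Fin n → ℚ) (I : Ideal (Tate π r))

omit [CompleteSpace K] in
lemma Tate.coe_incl (hπ : IsUniformizer π) {u : Fin n → ℚ} (hur : u ≤ r) (f : Tate π r) :
    (Tate.incl hπ hur f : MvPowerSeries (Fin n) K) = f := by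
  rw [Tate.incl, Subalgebra.coe_inclusion]

omit [CompleteSpace K] in
lemma Tate.coeff_incl (hπ : IsUniformizer π) {u : Fin n → ℚ} (hur : u ≤ r) (f : Tate π r)
    (k : Fin n →₀ ℕ) : Tate.coeff k (Tate.incl hπ hur f) = Tate.coeff k f := by
  rw [Tate.coeff_apply, Tate.coeff_apply, Tate.coe_incl]

omit [CompleteSpace K] in
lemma Tate.incl_X (hπ : IsUniformizer π) {u : Fin n → ℚ} (hur : u ≤ r) (i : Fin n) :
    Tate.incl hπ hur (Tate.X π r i) = Tate.X π u i :=
  Subtype.ext (by rw [Tate.coe_incl, Tate.X, Tate.X])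

omit [CompleteSpace K] in
lemma Tate.incl_monomial (hπ : IsUniformizer π) {u : Fin n → ℚ} (hur : u ≤ r) (k : Fin n →₀ ℕ) :
    Tate.incl hπ hur (Tate.monomial π r k) = Tate.monomial π u k :=
  Subtype.ext (by rw [Tate.coe_incl, Tate.monomial, Tate.monomial])

omit [CompleteSpace K] in
lemma Tate.norm_incl [Fact (π ≠ 0)] (hπ : IsUniformizer π) {u : Fin n → ℚ} (hur : u ≤ r)
    (f : Tate π r) : ‖Tate.incl hπ hur f‖ = gaussNorm π u f := by
  rw [Tate.norm_def, Tate.coe_incl]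

omit [CompleteSpace K] in
lemma aeval_mulX_apply (i : Fin n) (p : K[X]) (f : Tate π r) :
    aeval (mulX I i) p (Ideal.Quotient.mk I f) =
      Ideal.Quotient.mk I (aeval (Tate.X π r i) p * f) := by
  have h1 : mulX I i = Algebra.lmul K _ (Ideal.Quotient.mkₐ K I (Tate.X π r i)) := rfl
  rw [h1, aeval_algHom_apply, aeval_algHom_apply, map_mul]
  rfl

variable [Module.Finite K (Tate π r ⧸ I)]

/-- The slopes are cut at r, not u. By Cayley–Hamilton applied to the class of 1, Q(X_i) g(X_i) lies
in I, and Q(X_i) is already a unit of K{X; r}. -/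
lemma exists_dominantLead_mem [Fact (π ≠ 0)] (i : Fin n) :
    ∃ g : K[X], HasDominantLead (radii π r i) g ∧ aeval (Tate.X π r i) g ∈ I := by
  obtain ⟨hQ, g, hlead, hg⟩ := exists_bigFactor_mul_eq_zero π (-(r i : ℝ)) (mulX I i)
  refine ⟨g, hlead, ?_⟩
  have h := hg (Ideal.Quotient.mk I 1)
  rw [aeval_mulX_apply, mul_one, Ideal.Quotient.eq_zero_iff_mem, map_mul] at h
  exact (I.unit_mul_mem_iff_mem (Tate.isUnit_aeval_X i hQ)).mp h

/-- The projection of the Tate algebra to `W'`. -/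
def toQuotBig : Tate π r →ₗ[K] QuotBig u I :=
  (sumBig u I).mkQ.comp (Ideal.Quotient.mkₐ K I).toLinearMap

omit [CompleteSpace K] in
lemma toQuotBig_apply (f : Tate π r) :
    toQuotBig u I f = (sumBig u I).mkQ (Ideal.Quotient.mk I f) := rfl

omit [CompleteSpace K] in
lemma toQuotBig_surjective : Function.Surjective (toQuotBig u I) :=
  (Submodule.mkQ_surjective _).comp Ideal.Quotient.mk_surjective

omit [CompleteSpace K] in
lemma toQuotBig_eq_zero {f : Tate π r} (hf : f ∈ I) : toQuotBig u I f = 0 := by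
  rw [toQuotBig_apply, Ideal.Quotient.eq_zero_iff_mem.mpr hf, map_zero]

/-- At the slope -u_i the factor Q(X_i) need not be a unit of K{X; r}. Instead, Q(T_i) g(T_i) = 0
shows that g(T_i) maps V into the big part, which is killed in W'. -/
lemma exists_dominantLead_toQuotBig (i : Fin n) :
    ∃ g : K[X], HasDominantLead (radii π u i) g ∧
      ∀ f, toQuotBig u I (f * aeval (Tate.X π r i) g) = 0 := by
  obtain ⟨-, g, hlead, hg⟩ := exists_bigFactor_mul_eq_zero π (-(u i : ℝ)) (mulX I i)
  refine ⟨g, hlead, fun f => ?_⟩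
  rw [toQuotBig_apply, Submodule.mkQ_apply, Submodule.Quotient.mk_eq_zero]
  refine Submodule.mem_iSup_of_mem i ?_
  rw [mem_Big_iff]
  have h := hg (Ideal.Quotient.mk I f)
  rw [aeval_mulX_apply, map_mul (aeval (Tate.X π r i))] at h
  rw [aeval_mulX_apply, mul_comm f, ← mul_assoc]
  exact h

omit [CompleteSpace K] [Module.Finite K (Tate π r ⧸ I)] in
lemma mem_integers_iff {a : K} : a ∈ integers K ↔ ‖a‖ ≤ 1 := by
  rw [Valuation.mem_integer_iff, NormedField.valuation_apply]
  exact NNReal.coe_le_coe.symm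

/-- The `K°`-submodule of `W'` generated by the images of the terms `a X ^ k` of Gauss norm
at most `1`. -/
def termSpan : Submodule (integers K) (QuotBig u I) :=
  Submodule.span (integers K) {x | ∃ (a : K) (k : Fin n →₀ ℕ),
    ‖a‖ * weight (radii π u) k ≤ 1 ∧ a • toQuotBig u I (Tate.monomial π r k) = x}

omit [CompleteSpace K] in
lemma smul_monomial_mem_termSpan {a : K} {k : Fin n →₀ ℕ} (h : ‖a‖ * weight (radii π u) k ≤ 1) :
    a • toQuotBig u I (Tate.monomial π r k) ∈ termSpan u I :=
  Submodule.subset_span ⟨a, k, h, rfl⟩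

variable [Fact (π ≠ 0)]

variable {I} in
/-- The image of a small ball for the Gauss norm of log-radii `r` lies in the lattice. -/
lemma exists_toQuotBig_mem_termSpan (hπ : IsUniformizer π) :
    ∃ ε > 0, ∀ f : Tate π r, ‖f‖ ≤ ε → toQuotBig u I f ∈ termSpan u I := by
  choose g hg hgI using exists_dominantLead_mem I
  obtain ⟨s, C, hC, h⟩ := Tate.exists_remainder hπ g hg
  have hw := fun k => Tate.weight_pos (π := π) (r := u) k
  -- `B` bounds the weights at u of the finitely many remainder exponents, so an input of norm at
  -- most (C B)⁻¹ leaves a remainder made of admissible terms.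
  set B : ℝ := 1 + ∑ k ∈ s, weight (radii π u) k with hB
  have hsum : 0 ≤ ∑ k ∈ s, weight (radii π u) k := Finset.sum_nonneg fun k _ => (hw k).le
  have hBpos : 0 < B := by linarith
  refine ⟨(C * B)⁻¹, inv_pos.mpr (mul_pos hC hBpos), fun f hf => ?_⟩
  obtain ⟨x, rfl, hx⟩ := h f
  have hx' : ‖x‖ ≤ B⁻¹ := by
    refine hx.trans ((mul_le_mul_of_nonneg_left hf hC.le).trans_eq ?_)
    rw [mul_inv, mul_inv_cancel_left₀ hC.ne']
  rw [Tate.recombine_apply, map_add, map_sum, map_sum, Finset.sum_eq_zero fun i _ =>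
    toQuotBig_eq_zero u I (I.mul_mem_left _ (hgI i)), zero_add]
  refine Submodule.sum_mem _ fun k _ => ?_
  rw [map_smul]
  refine smul_monomial_mem_termSpan u I ?_
  have h1 : ‖x.2 k‖ ≤ B⁻¹ := (norm_le_pi_norm _ k).trans ((norm_snd_le x).trans hx')
  have h2 : weight (radii π u) k ≤ B := by
    have := Finset.single_le_sum (f := fun k => weight (radii π u) k) (fun k _ => (hw k).le) k.2
    linarith
  calc ‖x.2 k‖ * weight (radii π u) k ≤ B⁻¹ * B :=
        mul_le_mul h1 h2 (hw k).le (inv_nonneg.mpr hBpos.le)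
    _ = 1 := inv_mul_cancel₀ hBpos.ne'

variable {u I}

/-- Truncate `f` so that the tail is small for the norm at r; the tail then falls in the lattice by
division, and the finitely many remaining terms are generators. -/
lemma toQuotBig_mem_termSpan (hπ : IsUniformizer π) (hur : u ≤ r) {f : Tate π r}
    (hf : gaussNorm π u f ≤ 1) : toQuotBig u I f ∈ termSpan u I := by
  obtain ⟨ε, hε, h⟩ := exists_toQuotBig_mem_termSpan u (I := I) hπ
  obtain ⟨s, hs⟩ := Tate.exists_norm_sub_truncate_le f hε
  rw [← sub_add_cancel f (Tate.truncate s f), map_add]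
  refine add_mem (h _ hs) ?_
  rw [Tate.truncate, map_sum]
  refine Submodule.sum_mem _ fun k _ => ?_
  rw [map_smul]
  refine smul_monomial_mem_termSpan u I ?_
  rw [← Tate.norm_incl hπ hur] at hf
  rw [← Tate.coeff_incl hπ hur]
  exact (Tate.norm_coeff_le _ k).trans hf

omit [CompleteSpace K] in
lemma exists_gaussNorm_le_of_mem_termSpan (hπ : IsUniformizer π) (hur : u ≤ r) {w : QuotBig u I}
    (hw : w ∈ termSpan u I) : ∃ f : Tate π r, toQuotBig u I f = w ∧ gaussNorm π u f ≤ 1 := by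
  simp only [← Tate.norm_incl hπ hur]
  induction hw using Submodule.span_induction with
  | mem x hx =>
    obtain ⟨a, k, hak, rfl⟩ := hx
    refine ⟨a • Tate.monomial π r k, map_smul _ _ _, ?_⟩
    rw [map_smul, Tate.incl_monomial]
    exact (Tate.norm_smul_monomial a k).trans hak
  | zero =>
    refine ⟨0, map_zero _, ?_⟩
    rw [map_zero, norm_zero]
    exact zero_le_one
  | add x y _ _ hx hy =>
    obtain ⟨f, rfl, hf⟩ := hx
    obtain ⟨g, rfl, hg⟩ := hy
    refine ⟨f + g, map_add _ _ _, ?_⟩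
    rw [map_add]
    exact (IsUltrametricDist.norm_add_le_max _ _).trans (max_le hf hg)
  | smul c x _ hx =>
    obtain ⟨f, rfl, hf⟩ := hx
    refine ⟨(c : K) • f, map_smul _ _ _, ?_⟩
    rw [map_smul, norm_smul]
    exact mul_le_one₀ (mem_integers_iff.mp c.2) (norm_nonneg _) hf

-- The relations g_i(T_i) = 0 on W' reduce all exponents to a finite box. For each exponent there,
-- discreteness supplies one coefficient of maximal norm, which generates all the admissible ones.
variable (u I) in
lemma termSpan_fg (hπ : IsUniformizer π) : (termSpan u I).FG := by
  have hρ := radii_pos (Fact.out : π ≠ 0) u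
  have hw := fun k => Tate.weight_pos (π := π) (r := u) k
  choose g hg hgI using exists_dominantLead_toQuotBig u I
  choose b hb0 hb1 _ hb2 using fun k => hπ.exists_max_norm_le (inv_pos.mpr (hw k))
  set s : Finset (Fin n →₀ ℕ) :=
    Finset.Iic (Finsupp.equivFunOnFinite.symm fun i => (g i).natDegree)
  set M : Submodule (integers K) (QuotBig u I) := Submodule.span (integers K)
    ((fun k => b k • toQuotBig u I (Tate.monomial π r k)) '' s) with hM
  have hMfg : M.FG := Submodule.fg_span (s.finite_toSet.image _)
  suffices termSpan u I = M by rwa [this]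
  apply le_antisymm
  · refine Submodule.span_le.mpr ?_
    rintro _ ⟨a, k, hak, rfl⟩
    refine smul_mem_of_reduction M.toAddSubgroup hρ
      (fun k => toQuotBig u I (Tate.monomial π r k)) g hg ?_ ?_ k a hak
    · intro k hk a ha
      have hks : k ∈ s := Finset.mem_Iic.mpr fun i => (hk i).le
      have hab : ‖a‖ ≤ ‖b k‖ := hb2 k a (by rwa [← one_div, le_div_iff₀ (hw k)])
      have hmem : a / b k ∈ integers K := by
        rw [mem_integers_iff, norm_div]
        exact div_le_one_of_le₀ hab (norm_nonneg _)
      have := M.smul_mem ⟨a / b k, hmem⟩ (Submodule.subset_span ⟨k, hks, rfl⟩)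
      rw [Subring.smul_def, smul_smul, div_mul_cancel₀ _ (hb0 k)] at this
      exact this
    · intro k i a _
      have := hgI i (a • Tate.monomial π r k)
      rw [Tate.monomial_mul_aeval_X, map_sum] at this
      simp only [map_smul] at this
      rw [this]
      exact zero_mem _
  · refine Submodule.span_le.mpr ?_
    rintro _ ⟨k, -, rfl⟩
    refine smul_monomial_mem_termSpan u I ?_
    have := hb1 k
    rwa [← one_div, le_div_iff₀ (hw k)] at this

variable (u I) in
lemma span_termSpan (hπ : IsUniformizer π) (hur : u ≤ r) :
    Submodule.span K (termSpan u I : Set (QuotBig u I)) = ⊤ := by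
  refine eq_top_iff.mpr fun w _ => ?_
  obtain ⟨f, rfl⟩ := toQuotBig_surjective u I w
  obtain ⟨a, ha0, ha, -⟩ := hπ.exists_max_norm_le
    (c := (1 + ‖Tate.incl hπ hur f‖)⁻¹) (by positivity)
  have h : toQuotBig u I (a • f) ∈ termSpan u I := by
    refine toQuotBig_mem_termSpan hπ hur ?_
    rw [← Tate.norm_incl hπ hur, map_smul, norm_smul]
    rw [← one_div, le_div_iff₀ (by positivity)] at ha
    nlinarith [norm_nonneg a]
  rw [← inv_smul_smul₀ ha0 (toQuotBig u I f), ← map_smul]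
  exact Submodule.smul_mem _ _ (Submodule.subset_span h)

end Quotient

/-- A finitely generated `K°`-submodule of a vector space does not contain a line. -/
lemma eq_zero_of_forall_smul_mem {K V : Type*} [NontriviallyNormedField K] [IsUltrametricDist K]
    [AddCommGroup V] [Module K V] {L : Submodule (integers K) V} (hL : L.FG) {x : V}
    (hx : ∀ a : K, a • x ∈ L) : x = 0 := by
  -- Each linear functional is bounded on a finitely generated lattice, hence vanishes on any line
  -- that the lattice contains.
  rw [← Module.forall_dual_apply_eq_zero_iff K x]
  intro φ
  obtain ⟨s, rfl⟩ := hL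
  have hbound : ∀ v ∈ Submodule.span (integers K) (s : Set V), ‖φ v‖ ≤ ∑ y ∈ s, ‖φ y‖ := by
    intro v hv
    have h0 : 0 ≤ ∑ y ∈ s, ‖φ y‖ := Finset.sum_nonneg fun y _ => norm_nonneg _
    induction hv using Submodule.span_induction with
    | mem y hy => exact Finset.single_le_sum (f := fun y => ‖φ y‖) (fun y _ => norm_nonneg _) hy
    | zero => simpa using h0
    | add y z _ _ hy hz =>
      rw [map_add]
      exact (IsUltrametricDist.norm_add_le_max _ _).trans (max_le hy hz)
    | smul c y _ hy =>
      rw [Subring.smul_def, map_smul, norm_smul]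
      exact (mul_le_of_le_one_left (norm_nonneg _) (mem_integers_iff.mp c.2)).trans hy
  by_contra hφ
  obtain ⟨a, ha⟩ := NormedField.exists_lt_norm K ((∑ y ∈ s, ‖φ y‖) / ‖φ x‖)
  have h := hbound _ (hx a)
  rw [div_lt_iff₀ (norm_pos_iff.mpr hφ)] at ha
  rw [map_smul, norm_smul] at h
  exact absurd h (not_le.mpr ha)

lemma prod_zpow_eq {F ι : Type*} [Field F] {y : F} (hy : y ≠ 0) (s : Finset ι) (f : ι → ℤ) :
    ∏ i ∈ s, y ^ f i = y ^ ∑ i ∈ s, f i := by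
  classical
  induction s using Finset.induction_on with
  | empty => simp
  | insert i s hi ih => rw [Finset.prod_insert hi, Finset.sum_insert hi, ih, zpow_add₀ hy]

/-! ### The lattice of terms as the unit ball -/

section UnitBall

variable {K : Type*} [NontriviallyNormedField K] [IsUltrametricDist K]
  {n : ℕ} {π : K} {r : Fin n → ℚ}

omit [IsUltrametricDist K] in
/-- The Gauss norms of the terms `a X ^ k` lie in a discrete subgroup of `ℝ`, so that there is a gap
above `1`. -/
lemma exists_gap_weight (hπ : IsUniformizer π) (u : Fin n → ℚ) : ∃ c > 1, ∀ (a : K)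
    (k : Fin n →₀ ℕ), ‖a‖ * weight (radii π u) k < c → ‖a‖ * weight (radii π u) k ≤ 1 := by
  -- With `m` a common denominator of the log-radii, the `m`-th powers of nonzero weighted norms are
  -- integral powers of ‖π‖⁻¹, so the gap is an `m`-th root of ‖π‖⁻¹.
  set m : ℕ := ∏ i, (u i).den with hm
  have hm0 : 0 < m := Finset.prod_pos fun i _ => (u i).den_pos
  have hint : ∀ i, ∃ z : ℤ, (u i : ℝ) * m = z := by
    intro i
    obtain ⟨t, ht⟩ : (u i).den ∣ m := Finset.dvd_prod_of_mem _ (Finset.mem_univ i)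
    refine ⟨(u i).num * t, ?_⟩
    have := Rat.mul_den_eq_num (u i)
    rw [ht]
    push_cast
    rw [← mul_assoc]
    exact_mod_cast congrArg (fun q : ℚ => (q : ℝ) * (t : ℝ)) this
  choose z hz using hint
  set y : ℝ := ‖π‖⁻¹ with hy
  have hy1 : 1 < y := (one_lt_inv₀ hπ.norm_pos).mpr hπ.norm_lt_one
  have hpow : ∀ i, radii π u i ^ m = y ^ z i := by
    intro i
    rw [radii, ← Real.rpow_natCast, ← Real.rpow_mul (norm_nonneg _), neg_mul, hz,
      Real.rpow_neg (norm_nonneg _), Real.rpow_intCast, hy, inv_zpow]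
  refine ⟨y ^ ((m : ℝ)⁻¹), Real.one_lt_rpow hy1 (by positivity), fun a k h => ?_⟩
  have hw := weight_pos (radii_pos hπ.ne_zero u) k
  rcases eq_or_ne a 0 with rfl | ha
  · rw [norm_zero, zero_mul]
    exact zero_le_one
  obtain ⟨v, hv⟩ := hπ.discrete a ha
  obtain ⟨e, he⟩ : ∃ e : ℤ, (‖a‖ * weight (radii π u) k) ^ m = y ^ e := by
    refine ⟨-v * m + ∑ i, z i * k i, ?_⟩
    have hy0 : y ≠ 0 := by positivity
    rw [mul_pow, zpow_add₀ hy0, zpow_mul, zpow_natCast, weight_eq, ← Finset.prod_pow]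
    congr 1
    · rw [hv, hy, inv_zpow, zpow_neg, inv_inv]
    · rw [← prod_zpow_eq hy0]
      refine Finset.prod_congr rfl fun i _ => ?_
      rw [← pow_mul, mul_comm, pow_mul, hpow, zpow_mul, zpow_natCast]
  have h0 : 0 ≤ ‖a‖ * weight (radii π u) k := mul_nonneg (norm_nonneg _) hw.le
  have hlt := pow_lt_pow_left₀ h h0 hm0.ne'
  rw [Real.rpow_inv_natCast_pow (zero_le_one.trans hy1.le) hm0.ne', he] at hlt
  have he0 : e ≤ 0 := by
    have := (zpow_lt_zpow_iff_right₀ hy1).mp (hlt.trans_eq (zpow_one y).symm)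
    lia
  refine (pow_le_one_iff_of_nonneg h0 hm0.ne').mp ?_
  rw [he]
  exact zpow_le_one_of_nonpos₀ hy1.le he0

variable {u : Fin n → ℚ} {I : Ideal (Tate π r)}

omit [IsUltrametricDist K] in
lemma gaussNorm_nonneg (f : MvPowerSeries (Fin n) K) : 0 ≤ gaussNorm π u f :=
  MvPowerSeries.gaussNorm_nonneg _ _ _ norm_nonneg

lemma seminormV_nonneg (x : Tate π r ⧸ I) : 0 ≤ seminormV u I x :=
  Real.iInf_nonneg fun _ => gaussNorm_nonneg _

lemma seminormV_le (f : Tate π r) : seminormV u I (Ideal.Quotient.mk I f) ≤ gaussNorm π u f :=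
  ciInf_le (f := fun g : {g : Tate π r // Ideal.Quotient.mk I g = Ideal.Quotient.mk I f} =>
    gaussNorm π u (g.1 : MvPowerSeries (Fin n) K))
    ⟨0, Set.forall_mem_range.mpr fun _ => gaussNorm_nonneg _⟩ ⟨f, rfl⟩

lemma exists_gaussNorm_lt {x : Tate π r ⧸ I} {c : ℝ} (h : seminormV u I x < c) :
    ∃ f : Tate π r, Ideal.Quotient.mk I f = x ∧ gaussNorm π u f < c := by
  have : Nonempty {f : Tate π r // Ideal.Quotient.mk I f = x} :=
    (Ideal.Quotient.mk_surjective x).elim fun f hf => ⟨⟨f, hf⟩⟩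
  obtain ⟨⟨f, hf⟩, hlt⟩ := exists_lt_of_ciInf_lt h
  exact ⟨f, hf, hlt⟩

lemma gaussNorm_le_one_of_lt [Fact (π ≠ 0)] (hπ : IsUniformizer π) (hur : u ≤ r) {c : ℝ}
    (hc : ∀ (a : K) (k : Fin n →₀ ℕ), ‖a‖ * weight (radii π u) k < c →
      ‖a‖ * weight (radii π u) k ≤ 1) {f : Tate π r} (h : gaussNorm π u f < c) :
    gaussNorm π u f ≤ 1 := by
  rw [← Tate.norm_incl hπ hur] at h ⊢
  exact Tate.norm_le fun k => hc _ k ((Tate.norm_coeff_le _ k).trans_lt h)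

variable [Module.Finite K (Tate π r ⧸ I)]

lemma seminormQuot_le (f : Tate π r) :
    seminormQuot u I (toQuotBig u I f) ≤ gaussNorm π u f :=
  (ciInf_le (f := fun x : {x : Tate π r ⧸ I // (sumBig u I).mkQ x = toQuotBig u I f} =>
    seminormV u I x.1) ⟨0, Set.forall_mem_range.mpr fun _ => seminormV_nonneg _⟩
      ⟨Ideal.Quotient.mk I f, rfl⟩).trans (seminormV_le f)

lemma exists_gaussNorm_lt_of_seminormQuot_lt {w : QuotBig u I} {c : ℝ}
    (h : seminormQuot u I w < c) :
    ∃ f : Tate π r, toQuotBig u I f = w ∧ gaussNorm π u f < c := by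
  have : Nonempty {x : Tate π r ⧸ I // (sumBig u I).mkQ x = w} :=
    (Submodule.mkQ_surjective _ w).elim fun x hx => ⟨⟨x, hx⟩⟩
  obtain ⟨⟨x, hx⟩, hlt⟩ := exists_lt_of_ciInf_lt h
  obtain ⟨f, rfl, hf⟩ := exists_gaussNorm_lt hlt
  exact ⟨f, hx, hf⟩

/-- A seminorm at most 1 provides only lifts of norm below any c > 1; the gap turns such a lift into
one of norm at most 1, so attainment of the infimum need not be known beforehand. -/
theorem coe_termSpan [CompleteSpace K] [Fact (π ≠ 0)] (hπ : IsUniformizer π) (hur : u ≤ r) :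
    (termSpan u I : Set (QuotBig u I)) = {w | seminormQuot u I w ≤ 1} := by
  ext w
  constructor
  · intro hw
    obtain ⟨f, rfl, hf⟩ := exists_gaussNorm_le_of_mem_termSpan hπ hur hw
    exact (seminormQuot_le f).trans hf
  · intro hw
    obtain ⟨c, hc1, hc⟩ := exists_gap_weight hπ u
    obtain ⟨f, rfl, hf⟩ := exists_gaussNorm_lt_of_seminormQuot_lt
      (lt_of_le_of_lt (show seminormQuot u I w ≤ 1 from hw) hc1)
    exact toQuotBig_mem_termSpan hπ hur (gaussNorm_le_one_of_lt hπ hur hc hf)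

end UnitBall

/-! ### The cycle of inclusions between the kernels -/

section Kernels

variable {K : Type*} [NontriviallyNormedField K] [IsUltrametricDist K]
  {n : ℕ} {π : K} {r u : Fin n → ℚ} {I : Ideal (Tate π r)}

lemma Phi_mk (hπ : IsUniformizer π) (hur : u ≤ r) (f : Tate π r) :
    Phi I hπ hur (Ideal.Quotient.mk I f) = Ideal.Quotient.mk _ (Tate.incl hπ hur f) := rfl

lemma dense_range_incl [Fact (π ≠ 0)] (hπ : IsUniformizer π) (hur : u ≤ r) :
    DenseRange (Tate.incl hπ hur) := by
  intro f
  have hf : f ∈ (Tate.polynomials π u).topologicalClosure := by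
    rw [Tate.topologicalClosure_polynomials]
    exact AddSubgroup.mem_top f
  refine closure_mono ?_ hf
  rintro g ⟨s, hs⟩
  refine ⟨∑ k ∈ s, Tate.coeff k g • Tate.monomial π r k, ?_⟩
  rw [map_sum]
  refine Eq.trans ?_ hs.symm
  refine Finset.sum_congr rfl fun k _ => ?_
  rw [map_smul, Tate.incl_monomial]

/-- The image of I is stable only under K{X; r}, but that subring is dense in K{X; u}, so by
continuity the closure is stable under multiplication by K{X; u}. -/
lemma mem_closure_of_mem_map [Fact (π ≠ 0)] (hπ : IsUniformizer π) (hur : u ≤ r) {b : Tate π u}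
    (hb : b ∈ I.map (Tate.incl hπ hur)) : b ∈ closure (Tate.incl hπ hur '' I) := by
  induction hb using Submodule.span_induction with
  | mem x hx => exact subset_closure hx
  | zero => exact subset_closure ⟨0, I.zero_mem, map_zero _⟩
  | add x y _ _ hx hy =>
    refine map_mem_closure₂ continuous_add hx hy ?_
    rintro _ ⟨f, hf, rfl⟩ _ ⟨g, hg, rfl⟩
    exact ⟨f + g, I.add_mem hf hg, map_add _ _ _⟩
  | smul c x _ hx =>
    refine map_mem_closure₂ continuous_mul (dense_range_incl hπ hur c) hx ?_
    rintro _ ⟨f, rfl⟩ _ ⟨g, hg, rfl⟩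
    exact ⟨f * g, I.mul_mem_left f hg, map_mul _ _ _⟩

/-- A lift lying in J can be approximated at u by elements of I, and subtracting these does not
change its class. -/
lemma seminormV_eq_zero_of_Phi_eq_zero [Fact (π ≠ 0)] (hπ : IsUniformizer π) (hur : u ≤ r)
    {x : Tate π r ⧸ I} (hx : Phi I hπ hur x = 0) : seminormV u I x = 0 := by
  obtain ⟨f, rfl⟩ := Ideal.Quotient.mk_surjective x
  rw [Phi_mk, Ideal.Quotient.eq_zero_iff_mem] at hx
  refine le_antisymm (le_of_forall_pos_le_add fun ε hε => ?_) (seminormV_nonneg _)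
  obtain ⟨_, ⟨g, hg, rfl⟩, h⟩ := Metric.mem_closure_iff.mp (mem_closure_of_mem_map hπ hur hx) ε hε
  have hfg : Ideal.Quotient.mk I f = Ideal.Quotient.mk I (f - g) := by
    rw [map_sub, Ideal.Quotient.eq_zero_iff_mem.mpr hg, sub_zero]
  rw [dist_eq_norm, ← map_sub, Tate.norm_incl] at h
  rw [hfg, zero_add]
  exact (seminormV_le _).trans h.le

variable [CompleteSpace K] [Module.Finite K (Tate π r ⧸ I)]

lemma Phi_eq_zero_of_mem_sumBig [Fact (π ≠ 0)] (hπ : IsUniformizer π) (hur : u ≤ r) :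
    sumBig u I ≤ LinearMap.ker (Phi I hπ hur).toLinearMap := by
  refine iSup_le fun i x hx => ?_
  obtain ⟨f, rfl⟩ := Ideal.Quotient.mk_surjective x
  have hQ := (exists_bigFactor_mul_eq_zero π (-(u i : ℝ)) (mulX I i)).1
  rw [mem_Big_iff, aeval_mulX_apply, Ideal.Quotient.eq_zero_iff_mem] at hx
  have h := Ideal.mem_map_of_mem (Tate.incl hπ hur) hx
  rw [map_mul, ← aeval_algHom_apply, Tate.incl_X] at h
  rw [LinearMap.mem_ker, AlgHom.toLinearMap_apply, Phi_mk, Ideal.Quotient.eq_zero_iff_mem]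
  exact (Ideal.unit_mul_mem_iff_mem _ (Tate.isUnit_aeval_X i hQ)).mp h

lemma mem_sumBig_of_seminormV_eq_zero [Fact (π ≠ 0)] (hπ : IsUniformizer π) (hur : u ≤ r)
    {x : Tate π r ⧸ I} (hx : seminormV u I x = 0) : x ∈ sumBig u I := by
  rw [← Submodule.Quotient.mk_eq_zero, ← Submodule.mkQ_apply]
  refine eq_zero_of_forall_smul_mem (termSpan_fg u I hπ) fun a => ?_
  -- Seminorm zero permits a lift so small that multiplying it by `a` stays in the unit ball.
  obtain ⟨f, rfl, hf⟩ := exists_gaussNorm_lt (u := u) (x := x) (c := (‖a‖ + 1)⁻¹)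
    (hx.trans_lt (by positivity))
  rw [← toQuotBig_apply, ← map_smul]
  refine toQuotBig_mem_termSpan hπ hur ?_
  rw [← Tate.norm_incl hπ hur] at hf ⊢
  rw [map_smul, norm_smul]
  rw [← one_div, lt_div_iff₀ (by positivity)] at hf
  nlinarith [norm_nonneg (Tate.incl hπ hur f)]

end Kernels

/-! ### Minimality and iterated saturation -/

section Saturated

variable {K : Type*} [NontriviallyNormedField K] [IsUltrametricDist K]
  {n : ℕ} {π : K} {r u : Fin n → ℚ} {I : Ideal (Tate π r)} [Module.Finite K (Tate π r ⧸ I)]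

lemma mulXQuot_pow_toQuotBig (i : Fin n) (j : ℕ) (f : Tate π r) :
    (mulXQuot u I i ^ j) (toQuotBig u I f) = toQuotBig u I (Tate.X π r i ^ j * f) := by
  induction j with
  | zero => rw [pow_zero, pow_zero, one_mul, Module.End.one_apply]
  | succ j ih =>
    rw [pow_succ', Module.End.mul_apply, ih, pow_succ', mul_assoc]
    rfl

lemma list_prod_mulXQuot_toQuotBig (l : List (Fin n)) (k : Fin n → ℕ) (f : Tate π r) :
    (l.map fun i => mulXQuot u I i ^ k i).prod (toQuotBig u I f) =
      toQuotBig u I ((l.map fun i => Tate.X π r i ^ k i).prod * f) := by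
  induction l with
  | nil => rw [List.map_nil, List.map_nil, List.prod_nil, List.prod_nil, one_mul,
      Module.End.one_apply]
  | cons i l ih =>
    rw [List.map_cons, List.map_cons, List.prod_cons, List.prod_cons, Module.End.mul_apply, ih,
      mulXQuot_pow_toQuotBig, mul_assoc]

omit [Module.Finite K (Tate π r ⧸ I)] in
lemma list_prod_X_pow (k : Fin n → ℕ) :
    ((List.finRange n).map fun i => Tate.X π r i ^ k i).prod =
      Tate.monomial π r (Finsupp.equivFunOnFinite.symm k) := by
  have h : ∀ l : List (Fin n), (l.map fun i => Tate.X π r i ^ k i).prod =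
      Tate.monomial π r (l.map fun i => Finsupp.single i (k i)).sum := by
    intro l
    induction l with
    | nil => rfl
    | cons i l ih =>
      rw [List.map_cons, List.map_cons, List.prod_cons, List.sum_cons, Tate.monomial_add, ih,
        Tate.monomial_single]
  rw [h, ← List.ofFn_eq_map, List.sum_ofFn]
  congr 1
  ext i
  simp [Finsupp.finsetSum_apply, Finsupp.single_apply]

lemma ofFn_prod_mulXQuot_toQuotBig (k : Fin n → ℕ) (f : Tate π r) :
    (List.ofFn fun i => mulXQuot u I i ^ k i).prod (toQuotBig u I f) =
      toQuotBig u I (Tate.monomial π r (Finsupp.equivFunOnFinite.symm k) * f) := by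
  rw [List.ofFn_eq_map, list_prod_mulXQuot_toQuotBig, list_prod_X_pow]

lemma oneQuot_eq : oneQuot u I = toQuotBig u I (Tate.monomial π r 0) := rfl

lemma oneQuot_mem_termSpan : oneQuot u I ∈ termSpan u I := by
  have h := smul_monomial_mem_termSpan u I (a := (1 : K)) (k := 0) (by simp [weight_zero])
  rwa [one_smul] at h

lemma weight_equivFunOnFinite (ρ : Fin n → ℝ) (k : Fin n → ℕ) :
    weight ρ (Finsupp.equivFunOnFinite.symm k) = ∏ i, ρ i ^ k i := by
  rw [weight_eq]
  rfl

lemma isSaturated_termSpan [Fact (π ≠ 0)] : IsSaturated u I (termSpan u I) := by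
  intro a k hak x hx
  rw [← weight_equivFunOnFinite] at hak
  induction hx using Submodule.span_induction with
  | mem x hx =>
    obtain ⟨b, l, hbl, rfl⟩ := hx
    rw [map_smul, ofFn_prod_mulXQuot_toQuotBig, ← Tate.monomial_add, smul_smul]
    refine smul_monomial_mem_termSpan u I ?_
    rw [norm_mul, weight_add, mul_mul_mul_comm]
    exact mul_le_one₀ hak (mul_nonneg (norm_nonneg _) (Tate.weight_pos _).le) hbl
  | zero =>
    rw [map_zero, smul_zero]
    exact zero_mem _
  | add x y _ _ hx hy =>
    rw [map_add, smul_add]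
    exact add_mem hx hy
  | smul c x _ hx =>
    rw [Subring.smul_def, map_smul, smul_comm]
    exact (termSpan u I).smul_mem c hx

/-- Each generator is the image of 1 under one of the operators that saturation allows. -/
lemma termSpan_le {L : Submodule (integers K) (QuotBig u I)} (h1 : oneQuot u I ∈ L)
    (hL : IsSaturated u I L) : termSpan u I ≤ L := by
  refine Submodule.span_le.mpr ?_
  rintro _ ⟨a, k, hak, rfl⟩
  obtain ⟨k, rfl⟩ := Finsupp.equivFunOnFinite.symm.surjective k
  have h := hL a k (by rwa [← weight_equivFunOnFinite]) _ h1
  rw [oneQuot_eq, ofFn_prod_mulXQuot_toQuotBig, ← Tate.monomial_add, add_zero] at h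
  exact h

lemma mem_Sat {V : Type*} [AddCommGroup V] [Module K V] (f : Module.End K V)
    {L : Submodule (integers K) V} {x : V} (hx : x ∈ L) (k : ℕ) : (f ^ k) x ∈ Sat f L :=
  Submodule.mem_iSup_of_mem k ⟨x, hx, rfl⟩

lemma Sat_le {V : Type*} [AddCommGroup V] [Module K V] {f : Module.End K V}
    {L M : Submodule (integers K) V} (hL : L ≤ M) (hf : ∀ x ∈ M, f x ∈ M) : Sat f L ≤ M := by
  refine iSup_le fun k => ?_
  rintro _ ⟨x, hx, rfl⟩
  change (f ^ k) x ∈ M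
  induction k with
  | zero => exact hL hx
  | succ k ih =>
    rw [pow_succ', Module.End.mul_apply]
    exact hf _ ih

omit [IsUltrametricDist K] in
lemma norm_zpow_mul_radii (hπ : π ≠ 0) {w : Fin n → ℤ} (hw : ∀ i, u i = w i) (i : Fin n) :
    ‖π ^ w i‖ * radii π u i = 1 := by
  rw [radii, hw, Rat.cast_intCast, ← Int.cast_neg, Real.rpow_intCast, norm_zpow, zpow_neg]
  exact mul_inv_cancel₀ (zpow_ne_zero _ (norm_ne_zero_iff.mpr hπ))

lemma iterSat_le_termSpan [Fact (π ≠ 0)] {w : Fin n → ℤ} (hw : ∀ i, u i = w i) :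
    iterSat u I w (Submodule.span (integers K) {oneQuot u I}) ≤ termSpan u I := by
  rw [iterSat]
  induction List.finRange n with
  | nil =>
    exact Submodule.span_le.mpr (Set.singleton_subset_iff.mpr oneQuot_mem_termSpan)
  | cons i l ih =>
    refine Sat_le ih fun x hx => ?_
    -- For integral log-radii, the term π^{w_i} X_i has Gauss norm exactly 1, hence is allowed.
    have h := isSaturated_termSpan (π ^ w i) (Pi.single i 1) (by
      rw [← weight_equivFunOnFinite, Finsupp.equivFunOnFinite_symm_single, weight_single, pow_one,
        norm_zpow_mul_radii Fact.out hw]) x hx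
    obtain ⟨f, rfl⟩ := toQuotBig_surjective u I x
    rw [ofFn_prod_mulXQuot_toQuotBig, Finsupp.equivFunOnFinite_symm_single,
      Tate.monomial_single, ← mulXQuot_pow_toQuotBig, pow_one] at h
    exact h

lemma list_prod_smul_pow_mem (w : Fin n → ℤ) (L : Submodule (integers K) (QuotBig u I))
    (k : Fin n → ℕ) {x : QuotBig u I} (hx : x ∈ L) (l : List (Fin n)) :
    (l.map fun i => (π ^ w i • mulXQuot u I i) ^ k i).prod x ∈
      l.foldr (fun i M => Sat (π ^ w i • mulXQuot u I i) M) L := by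
  induction l with
  | nil => exact hx
  | cons i l ih =>
    rw [List.map_cons, List.prod_cons, Module.End.mul_apply, List.foldr_cons]
    exact mem_Sat _ ih _

omit [IsUltrametricDist K] in
lemma list_prod_smul_pow {V ι : Type*} [AddCommGroup V] [Module K V] (c : ι → K)
    (f : ι → Module.End K V) (k : ι → ℕ) (l : List ι) :
    (l.map fun i => (c i • f i) ^ k i).prod =
      (l.map fun i => c i ^ k i).prod • (l.map fun i => f i ^ k i).prod := by
  induction l with
  | nil => exact (one_smul K _).symm
  | cons i l ih =>
    rw [List.map_cons, List.map_cons, List.map_cons, List.prod_cons, List.prod_cons,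
      List.prod_cons, ih, _root_.smul_pow, smul_mul_smul_comm]

/-- The product of the (π^{w_i} X_i)^{k_i} is b X^k with Gauss norm exactly 1. A term a X^k of norm
at most 1 is therefore a / b times it, with a / b integral. -/
lemma termSpan_le_iterSat [Fact (π ≠ 0)] {w : Fin n → ℤ} (hw : ∀ i, u i = w i) :
    termSpan u I ≤ iterSat u I w (Submodule.span (integers K) {oneQuot u I}) := by
  refine Submodule.span_le.mpr ?_
  rintro _ ⟨a, k, hak, rfl⟩
  obtain ⟨k, rfl⟩ := Finsupp.equivFunOnFinite.symm.surjective k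
  have h := list_prod_smul_pow_mem (u := u) (I := I) w
    (Submodule.span (integers K) {oneQuot u I}) k (Submodule.mem_span_singleton_self _)
    (List.finRange n)
  set b : K := ((List.finRange n).map fun i => (π ^ w i) ^ k i).prod with hb
  have hbw : ‖b‖ * weight (radii π u) (Finsupp.equivFunOnFinite.symm k) = 1 := by
    rw [hb, ← List.ofFn_eq_map, List.prod_ofFn, norm_prod, weight_equivFunOnFinite,
      ← Finset.prod_mul_distrib]
    refine Finset.prod_eq_one fun i _ => ?_
    rw [norm_pow, ← mul_pow, norm_zpow_mul_radii Fact.out hw, one_pow]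
  have hb0 : b ≠ 0 := by
    rintro h0
    rw [h0, norm_zero, zero_mul] at hbw
    exact zero_ne_one hbw
  rw [list_prod_smul_pow, LinearMap.smul_apply, ← hb, oneQuot_eq, list_prod_mulXQuot_toQuotBig,
    list_prod_X_pow, ← Tate.monomial_add, add_zero] at h
  have hmem : a / b ∈ integers K := by
    rw [mem_integers_iff, norm_div]
    refine div_le_one_of_le₀ ?_ (norm_nonneg _)
    rw [← hbw] at hak
    exact le_of_mul_le_mul_right hak (Tate.weight_pos _)
  have h' := Submodule.smul_mem _ (⟨a / b, hmem⟩ : integers K) h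
  rw [Subring.smul_def, smul_smul, div_mul_cancel₀ _ hb0] at h'
  exact h'

end Saturated

end

end TateFGLM

theorem mainTheorem6 {K : Type*} [NontriviallyNormedField K] [IsUltrametricDist K]
    [CompleteSpace K] (π : K) (hπ : TateFGLM.IsUniformizer π) {n : ℕ} (r u : Fin n → ℚ)
    (hur : u ≤ r) (I : Ideal (TateFGLM.Tate π r))
    [Module.Finite K (TateFGLM.Tate π r ⧸ I)] :
    -- the kernel of `Φ`, and that of the seminorm on `V`, is `∑ i, Big_{-u_i}(T_i)`
    LinearMap.ker (TateFGLM.Phi I hπ hur).toLinearMap =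
        ⨆ i, TateFGLM.Big π (-(u i : ℝ)) (TateFGLM.mulX I i) ∧
    {x | TateFGLM.seminormV u I x = 0} =
        ((⨆ i, TateFGLM.Big π (-(u i : ℝ)) (TateFGLM.mulX I i) :
          Submodule K (TateFGLM.Tate π r ⧸ I)) : Set (TateFGLM.Tate π r ⧸ I)) ∧
    -- the unit ball of `V / ∑ i, Big_{-u_i}(T_i)` is a finitely generated saturated lattice,
    -- namely the saturation of the submodule generated by the image of `1`
    ∃ D : Submodule (TateFGLM.integers K) (TateFGLM.QuotBig u I),
      (D : Set (TateFGLM.QuotBig u I)) = {w | TateFGLM.seminormQuot u I w ≤ 1} ∧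
      D.FG ∧
      Submodule.span K (D : Set (TateFGLM.QuotBig u I)) = ⊤ ∧
      IsLeast {L : Submodule (TateFGLM.integers K) (TateFGLM.QuotBig u I) |
        TateFGLM.oneQuot u I ∈ L ∧ TateFGLM.IsSaturated u I L} D ∧
      ∀ w : Fin n → ℤ, (∀ i, u i = w i) →
        D = TateFGLM.iterSat u I w
          (Submodule.span (TateFGLM.integers K) {TateFGLM.oneQuot u I}) := by
  have : Fact (π ≠ 0) := ⟨hπ.ne_zero⟩
  have h1 := TateFGLM.Phi_eq_zero_of_mem_sumBig (I := I) hπ hur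
  refine ⟨le_antisymm (fun x hx => ?_) h1, ?_, TateFGLM.termSpan u I,
    TateFGLM.coe_termSpan hπ hur, TateFGLM.termSpan_fg u I hπ, TateFGLM.span_termSpan u I hπ hur,
    ⟨⟨TateFGLM.oneQuot_mem_termSpan, TateFGLM.isSaturated_termSpan⟩,
      fun L hL => TateFGLM.termSpan_le hL.1 hL.2⟩,
    fun w hw => le_antisymm (TateFGLM.termSpan_le_iterSat hw) (TateFGLM.iterSat_le_termSpan hw)⟩
  · exact TateFGLM.mem_sumBig_of_seminormV_eq_zero hπ hur
      (TateFGLM.seminormV_eq_zero_of_Phi_eq_zero hπ hur hx)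
  · ext x
    exact ⟨TateFGLM.mem_sumBig_of_seminormV_eq_zero hπ hur, fun hx =>
      TateFGLM.seminormV_eq_zero_of_Phi_eq_zero hπ hur (h1 hx)⟩
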